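/- Call a 2-dimensional real Banach space $X$, with unit sphere $S_X=\{x\in X:\|x\|=1\}$, *absolutely smooth* if there is a differentiable map $r:\mathbb R\to X$ with $r(\mathbb R)=S_X$ such that $\|r'(s)\|=1$ for all $s\in\mathbb R$ and the derivative $r'$ is locally absolutely continuous, i.e. every point of $\mathbb R$ has a neighbourhood $O$ such that for every $\varepsilon>0$ there is $\delta>0$ with $\sum_{i=1}^n\|r'(y_i)-r'(x_i)\|<\varepsilon$ for all $x_1<y_1<x_2<y_2<\dots<x_n<y_n$ in $O$ with $\sum_{i=1}^n(y_i-x_i)<\delta$. **Theorem.** Let $X$ and $Y$ be absolutely smooth 2-dimensional real Banach spaces and let $f:S_X\to S_Y$ be an isometry, i.e. $\|f(x)-f(x')\|=\|x-x'\|$ for all $x,x'\in S_X$. Then there is a surjective linear isometry $F:X\to Y$ with $F(x)=f(x)$ for all $x\in S_X$. -/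

import Mathlib

/-- A function on the real line is locally absolutely continuous if every point has a neighbourhood
on which the function is absolutely continuous (in the usual `ε`-`δ` sense; the neighbourhood can
be taken to be a compact interval `[a, b]`). -/
def LocallyAbsolutelyContinuous {E : Type*} [PseudoMetricSpace E] (g : ℝ → E) : Prop :=
  ∀ x : ℝ, ∃ a b : ℝ, a < x ∧ x < b ∧ AbsolutelyContinuousOnInterval g a b

/-- A (two-dimensional) real normed space is absolutely smooth if its unit sphere is the image of
the real line under a differentiable map with derivative of norm one everywhere and with locally
absolutely continuous derivative. -/
def AbsolutelySmooth (X : Type*) [NormedAddCommGroup X] [NormedSpace ℝ X] : Prop :=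
  ∃ r : ℝ → X,
    Set.range r = Metric.sphere (0 : X) 1 ∧
    Differentiable ℝ r ∧
    (∀ s : ℝ, ‖deriv r s‖ = 1) ∧
    LocallyAbsolutelyContinuous (deriv r)

/-!
Composing a unit-speed parametrization `r` of the sphere of `X` with `f` gives a curve `q` on the
sphere of `Y` with `‖q s - q t‖ = ‖r s - r t‖`. The theorem says that `q = F ∘ r` for a linear `F`.

**From the map to a pair of curves.** The curve `q` is again of unit speed with locally absolutely
continuous derivative: near each parameter it is a continuous injective reparametrization of the
given parametrization of the sphere of `Y`, whose difference quotients have absolute value tending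
to one, hence a shift up to orientation (`SphereCurve.eq_of_isometric`). Antipodes are preserved,
because the periods of a curve form a cyclic group, in which at most one class of half-periods
exists (`SphereCurve.antiperiodic_of_isometric`). So the sums `‖q s + q t‖ = ‖r s + r t‖` are
available too. A change of parameter turns `r` into a curve `x` with `D(x, x') = 1` for the area
form `D`, and `q` into a curve `y`. This is the situation of `HillPair`. By Cramer's identity
`x'' = -e x` almost everywhere (`HillPair.hill`), while `y'' = -e₁ y + b y'`. It has to be shown
that `e₁ = e` and `b = 0`: then `D(v, x') y - D(v, x) y'` is constant for every vector `v`, and this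
constant depends linearly on `v` and equals `y s` for `v = x s` (`HillPair.exists_linearMap`).

**The function `P(s, t) = ‖x s + x t‖ = ‖y s + y t‖`.** For `s` close to `t` there is a bisecting
parameter `θ(s, t)` between `s` and `t` with `x s + x t = P x(θ)`. Polar coordinates show that `P`
and `θ` are differentiable, and that the mixed second derivative of `P` is `P · e(θ) · θ_s · θ_t`,
where it exists (`SphereCurve.hasDerivAt_mixed`). If `χ` is the bisector of `y`, then
`e(θ) θ_s θ_t = e₁(χ) χ_s χ_t`. Near the diagonal `P(m - η, m + η) = 2 - e(m) η² + o(η²)`, and the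
same with `e₁`; so `e = e₁ ≥ 0` almost everywhere. Moreover `θ(m - η, m + η) = m + o(η²)` and
`χ(m - η, m + η) = m + b(m) η² / 2 + o(η²)`
(`SphereCurve.hasDerivWithinAt_near_diagonal`).

**The comparison.** Move the midpoint `σ` along a band `t - s = 2 η`. The speed of the bisector is
the sum of its two partial derivatives, so by the inequality of the arithmetic and geometric means
`√e(χ) χ' ≥ 2 √(e(χ) χ_s χ_t) = 2 √(e(θ) θ_s θ_t)`. For `x` the two partial derivatives differ only
by a factor `1 + o(η)`, since the acceleration is radial, whence the right-hand side is at least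
`(1 - o(η²)) √e(θ) θ'` (`HillPair.speed_le`). Integrate from `σ = m₁` to `σ = m₂`. At order `η²`
there remain only the displacements of the end points, and they give
`√e(m₁) b(m₁) ≤ √e(m₂) b(m₂)` for `m₁ ≤ m₂` (`HillPair.tangential_le`). As a nondecreasing
periodic function, `√e b` is constant. The constant is zero: otherwise `b` would have a strict sign,
and `D(y, y')`, whose derivative is `b D(y, y')`, would not be periodic. So `b = 0` where `e ≠ 0`.
Where `e = 0` also `b = 0`, since there `b` is the logarithmic derivative of the speed `‖y'‖ = ‖x'‖`
and `x'' = 0` (`HillPair.tangential_eq_zero`).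
-/

open MeasureTheory Filter Topology Set

/-! ### Locally absolutely continuous functions on the line -/

section LocallyAC

/-- Absolute continuity is inherited by any function whose increments are dominated by those of
two absolutely continuous functions. -/
theorem AbsolutelyContinuousOnInterval.of_dist_le {E F G : Type*} [PseudoMetricSpace E]
    [PseudoMetricSpace F] [PseudoMetricSpace G] {f : ℝ → E} {g : ℝ → F} {h : ℝ → G} {a b K : ℝ}
    (hf : AbsolutelyContinuousOnInterval f a b) (hg : AbsolutelyContinuousOnInterval g a b)
    (H : ∀ u ∈ uIcc a b, ∀ v ∈ uIcc a b, dist (h u) (h v) ≤ K * (dist (f u) (f v) +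
      dist (g u) (g v))) :
    AbsolutelyContinuousOnInterval h a b := by
  unfold AbsolutelyContinuousOnInterval at hf hg ⊢
  refine squeeze_zero' (Eventually.of_forall fun _ => Finset.sum_nonneg fun i _ => dist_nonneg)
    ?_ (by simpa using (hf.add hg).const_mul K)
  rw [eventually_inf_principal]
  refine Eventually.of_forall ?_
  rintro ⟨n, I⟩ hnI
  rw [← Finset.sum_add_distrib, Finset.mul_sum]
  exact Finset.sum_le_sum fun i hi => H _ (hnI.1 i hi).1 _ (hnI.1 i hi).2

namespace LocallyAbsolutelyContinuous

variable {E F G : Type*} [PseudoMetricSpace E] [PseudoMetricSpace F] [PseudoMetricSpace G]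

theorem of_dist_le {f : ℝ → E} {g : ℝ → F} {h : ℝ → G} (hf : LocallyAbsolutelyContinuous f)
    (hg : LocallyAbsolutelyContinuous g)
    (H : ∀ a b : ℝ, ∃ K, ∀ u ∈ Icc a b, ∀ v ∈ Icc a b, dist (h u) (h v) ≤
      K * (dist (f u) (f v) + dist (g u) (g v))) :
    LocallyAbsolutelyContinuous h := by
  intro x
  obtain ⟨a, b, hax, hxb, h1⟩ := hf x
  obtain ⟨c, d, hcx, hxd, h2⟩ := hg x
  have hlt : max a c < x := max_lt hax hcx
  have hgt : x < min b d := lt_min hxb hxd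
  obtain ⟨K, hK⟩ := H (max a c) (min b d)
  refine ⟨max a c, min b d, hlt, hgt, ?_⟩
  have hle := (hlt.trans hgt).le
  have e1 : uIcc (max a c) (min b d) ⊆ uIcc a b := by
    rw [uIcc_of_le hle, uIcc_of_le (hax.trans hxb).le]
    exact Icc_subset_Icc (le_max_left _ _) (min_le_left _ _)
  have e2 : uIcc (max a c) (min b d) ⊆ uIcc c d := by
    rw [uIcc_of_le hle, uIcc_of_le (hcx.trans hxd).le]
    exact Icc_subset_Icc (le_max_right _ _) (min_le_right _ _)
  refine (h1.mono e1).of_dist_le (h2.mono e2) (K := K) ?_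
  rwa [uIcc_of_le hle]

theorem of_dist_le_left {f : ℝ → E} {h : ℝ → G} (hf : LocallyAbsolutelyContinuous f)
    (H : ∀ a b : ℝ, ∃ K, ∀ u ∈ Icc a b, ∀ v ∈ Icc a b, dist (h u) (h v) ≤ K * dist (f u) (f v)) :
    LocallyAbsolutelyContinuous h := by
  refine hf.of_dist_le hf fun a b => ?_
  obtain ⟨K, hK⟩ := H a b
  refine ⟨K / 2, fun u hu v hv => (hK u hu v hv).trans (le_of_eq (by ring))⟩

protected theorem continuous {E : Type*} [SeminormedAddCommGroup E] {f : ℝ → E}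
    (hf : LocallyAbsolutelyContinuous f) : Continuous f := by
  rw [continuous_iff_continuousAt]
  intro x
  obtain ⟨a, b, hax, hxb, h1⟩ := hf x
  have h2 := h1.continuousOn
  rw [uIcc_of_le (hax.trans hxb).le] at h2
  exact h2.continuousAt (Icc_mem_nhds hax hxb)

end LocallyAbsolutelyContinuous

variable {X Y Z : Type*} [NormedAddCommGroup X] [NormedSpace ℝ X] [NormedAddCommGroup Y]
  [NormedSpace ℝ Y] [NormedAddCommGroup Z] [NormedSpace ℝ Z]

namespace LocallyAbsolutelyContinuous

theorem of_continuous_deriv {f f' : ℝ → X} (hf : ∀ s, HasDerivAt f (f' s) s)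
    (hf' : Continuous f') : LocallyAbsolutelyContinuous f := by
  intro x
  refine ⟨x - 1, x + 1, by linarith, by linarith, ?_⟩
  refine ContDiffOn.absolutelyContinuousOnInterval (ContDiff.contDiffOn ?_)
  rw [contDiff_one_iff_deriv]
  refine ⟨fun s => (hf s).differentiableAt, ?_⟩
  rwa [show deriv f = f' from funext fun s => (hf s).deriv]

/-- A continuous bilinear map sends two locally absolutely continuous functions to one. -/
theorem bilin (B : X →L[ℝ] Y →L[ℝ] Z) {f : ℝ → X} {g : ℝ → Y}
    (hf : LocallyAbsolutelyContinuous f) (hg : LocallyAbsolutelyContinuous g) :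
    LocallyAbsolutelyContinuous fun s => B (f s) (g s) := by
  refine hf.of_dist_le hg fun a b => ?_
  obtain ⟨C, hC⟩ := (isCompact_Icc (a := a) (b := b)).exists_bound_of_continuousOn
    hf.continuous.continuousOn
  obtain ⟨C', hC'⟩ := (isCompact_Icc (a := a) (b := b)).exists_bound_of_continuousOn
    hg.continuous.continuousOn
  refine ⟨‖B‖ * (max C C'), fun u hu v hv => ?_⟩
  have key : B (f u) (g u) - B (f v) (g v) = B (f u - f v) (g u) + B (f v) (g u - g v) := by
    simp only [map_sub, sub_apply]; abel
  rw [dist_eq_norm, key, dist_eq_norm, dist_eq_norm]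
  have h1 : ‖B (f u - f v) (g u)‖ ≤ ‖B‖ * ‖f u - f v‖ * max C C' :=
    (B.le_opNorm₂ _ _).trans
      (mul_le_mul_of_nonneg_left ((hC' u hu).trans (le_max_right _ _)) (by positivity))
  have h2 : ‖B (f v) (g u - g v)‖ ≤ ‖B‖ * max C C' * ‖g u - g v‖ :=
    (B.le_opNorm₂ _ _).trans (mul_le_mul_of_nonneg_right
      (mul_le_mul_of_nonneg_left ((hC v hv).trans (le_max_left _ _)) (by positivity))
      (by positivity))
  calc _ ≤ _ := norm_add_le _ _
    _ ≤ _ := add_le_add h1 h2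
    _ = _ := by ring

theorem clm (A : X →L[ℝ] Y) {f : ℝ → X} (hf : LocallyAbsolutelyContinuous f) :
    LocallyAbsolutelyContinuous fun s => A (f s) := by
  refine hf.of_dist_le_left fun a b => ⟨‖A‖, fun u _ v _ => ?_⟩
  rw [dist_eq_norm, dist_eq_norm, ← map_sub]
  exact A.le_opNorm _

theorem smul {f : ℝ → ℝ} {g : ℝ → X}
    (hf : LocallyAbsolutelyContinuous f) (hg : LocallyAbsolutelyContinuous g) :
    LocallyAbsolutelyContinuous fun s => f s • g s :=
  bilin (ContinuousLinearMap.lsmul ℝ ℝ) hf hg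

theorem inv {f : ℝ → ℝ} (hf : LocallyAbsolutelyContinuous f) (h0 : ∀ s, 0 < f s) :
    LocallyAbsolutelyContinuous fun s => (f s)⁻¹ := by
  refine hf.of_dist_le_left fun a b => ?_
  obtain ⟨C, hC⟩ := (isCompact_Icc (a := a) (b := b)).exists_bound_of_continuousOn
    (f := fun s => (f s)⁻¹) (hf.continuous.inv₀ fun s => (h0 s).ne').continuousOn
  refine ⟨C * C, fun u hu v hv => ?_⟩
  have e : (f u)⁻¹ - (f v)⁻¹ = (f u)⁻¹ * (f v)⁻¹ * (f v - f u) := by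
    have := (h0 u).ne'; have := (h0 v).ne'; field_simp
  have hC0 : 0 ≤ C := (norm_nonneg _).trans (hC u hu)
  rw [dist_comm (f u), Real.dist_eq, Real.dist_eq, e, abs_mul, abs_mul]
  gcongr
  · exact hC u hu
  · exact hC v hv

theorem sub {E : Type*} [SeminormedAddCommGroup E] {f g : ℝ → E}
    (hf : LocallyAbsolutelyContinuous f) (hg : LocallyAbsolutelyContinuous g) :
    LocallyAbsolutelyContinuous fun s => f s - g s := by
  refine hf.of_dist_le hg fun a b => ⟨1, fun u _ v _ => ?_⟩
  rw [one_mul, dist_eq_norm, dist_eq_norm, dist_eq_norm,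
    show f u - g u - (f v - g v) = (f u - f v) - (g u - g v) by abel]
  exact norm_sub_le _ _

/-- Precomposition with an increasing `C¹` change of variable. -/
theorem comp_strictMono {E : Type*} [PseudoMetricSpace E] {f : ℝ → E} {g g' : ℝ → ℝ}
    (hf : LocallyAbsolutelyContinuous f) (hg : ∀ s, HasDerivAt g (g' s) s) (hg' : Continuous g')
    (hm : StrictMono g) : LocallyAbsolutelyContinuous fun s => f (g s) := by
  have hgc : Continuous g := continuous_iff_continuousAt.2 fun s => (hg s).continuousAt
  intro x
  obtain ⟨a, b, hax, hxb, h1⟩ := hf (g x)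
  have hmem : g ⁻¹' Ioo a b ∈ 𝓝 x := hgc.continuousAt (Ioo_mem_nhds hax hxb)
  obtain ⟨c, d, ⟨hcx, hxd⟩, hcd⟩ := (mem_nhds_iff_exists_Ioo_subset.1 hmem)
  have hc1 : (c + x) / 2 < x := by linarith
  have hd1 : x < (x + d) / 2 := by linarith
  refine ⟨(c + x) / 2, (x + d) / 2, hc1, hd1, ?_⟩
  have hle := (hc1.trans hd1).le
  have hsub : ∀ u ∈ uIcc ((c + x) / 2) ((x + d) / 2), g u ∈ uIcc a b := by
    intro u hu
    rw [uIcc_of_le hle] at hu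
    rw [uIcc_of_le (hax.trans hxb).le]
    exact Ioo_subset_Icc_self (hcd ⟨by linarith [hu.1], by linarith [hu.2]⟩)
  obtain ⟨K, hK⟩ := (isCompact_Icc (a := (c + x) / 2)
    (b := (x + d) / 2)).exists_bound_of_continuousOn hg'.continuousOn
  have hlip : ∀ u ∈ Icc ((c + x) / 2) ((x + d) / 2), ∀ v ∈ Icc ((c + x) / 2) ((x + d) / 2),
      dist (g u) (g v) ≤ K * dist u v := by
    intro u hu v hv
    rw [dist_eq_norm, dist_eq_norm]
    exact (convex_Icc _ _).norm_image_sub_le_of_norm_hasDerivWithin_le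
      (fun s _ => (hg s).hasDerivWithinAt) hK hv hu
  have hK0 : 0 ≤ K := (norm_nonneg _).trans (hK x ⟨hc1.le, hd1.le⟩)
  rw [absolutelyContinuousOnInterval_iff] at h1 ⊢
  intro ε hε
  obtain ⟨δ, hδ, H⟩ := h1 ε hε
  refine ⟨δ / (K + 1), by positivity, ?_⟩
  rintro ⟨n, I⟩ ⟨hI1, hI2⟩ hsum
  refine H (n, fun i => (g (I i).1, g (I i).2)) ⟨fun i hi => ?_, ?_⟩ ?_
  · exact ⟨hsub _ (hI1 i hi).1, hsub _ (hI1 i hi).2⟩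
  · intro i hi j hj hij
    have hd := hI2 hi hj hij
    simp only [Function.onFun, uIoc, ← hm.monotone.map_min, ← hm.monotone.map_max] at hd ⊢
    rw [Ioc_disjoint_Ioc] at hd ⊢
    rw [← hm.monotone.map_min, ← hm.monotone.map_max]
    exact hm.monotone hd
  · calc _ ≤ ∑ i ∈ Finset.range n, K * dist (I i).1 (I i).2 := by
          refine Finset.sum_le_sum fun i hi => hlip _ ?_ _ ?_
          · rw [← uIcc_of_le hle]; exact (hI1 i hi).1
          · rw [← uIcc_of_le hle]; exact (hI1 i hi).2
      _ = K * ∑ i ∈ Finset.range n, dist (I i).1 (I i).2 := by rw [Finset.mul_sum]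
      _ ≤ K * (δ / (K + 1)) := by gcongr
      _ < (K + 1) * (δ / (K + 1)) := by gcongr; linarith
      _ = δ := by field_simp

theorem comp_neg {E : Type*} [PseudoMetricSpace E] {f : ℝ → E}
    (hf : LocallyAbsolutelyContinuous f) : LocallyAbsolutelyContinuous fun s => f (-s) := by
  intro x
  obtain ⟨a, b, hax, hxb, h1⟩ := hf (-x)
  refine ⟨-b, -a, by linarith, by linarith, ?_⟩
  rw [absolutelyContinuousOnInterval_iff] at h1 ⊢
  intro ε hε
  obtain ⟨δ, hδ, H⟩ := h1 ε hε
  refine ⟨δ, hδ, ?_⟩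
  rintro ⟨n, I⟩ ⟨hI1, hI2⟩ hsum
  have hmem : ∀ {u}, u ∈ uIcc (-b) (-a) → -u ∈ uIcc a b := fun {u} hu => by
    rw [uIcc_of_le (by linarith)] at hu ⊢
    exact ⟨by linarith [hu.2], by linarith [hu.1]⟩
  refine H (n, fun i => (-(I i).1, -(I i).2))
    ⟨fun i hi => ⟨hmem (hI1 i hi).1, hmem (hI1 i hi).2⟩, fun i hi j hj hij => ?_⟩ ?_
  · have hd := hI2 hi hj hij
    simp only [Function.onFun, uIoc, Ioc_disjoint_Ioc, min_neg_neg, max_neg_neg] at hd ⊢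
    rw [neg_le_neg_iff]
    rw [min_comm, max_comm]
    simpa only [max_comm, min_comm] using hd
  · simpa only [dist_neg_neg] using hsum

theorem ae_differentiableAt_real {f : ℝ → ℝ} (hf : LocallyAbsolutelyContinuous f) :
    ∀ᵐ s, DifferentiableAt ℝ f s := by
  rw [ae_iff]
  refine measure_null_of_locally_null _ fun x _ => ?_
  obtain ⟨a, b, hax, hxb, h1⟩ := hf x
  have h2 := h1.ae_differentiableAt
  rw [ae_iff] at h2
  refine ⟨{s | ¬ DifferentiableAt ℝ f s} ∩ Icc a b,
    Filter.inter_mem self_mem_nhdsWithin (mem_nhdsWithin_of_mem_nhds (Icc_mem_nhds hax hxb)),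
    measure_mono_null ?_ h2⟩
  rintro s ⟨hs, hs'⟩ h
  exact hs (h (by rwa [uIcc_of_le (hax.trans hxb).le]))

theorem locallyIntegrable_deriv_real {f : ℝ → ℝ} (hf : LocallyAbsolutelyContinuous f) :
    LocallyIntegrable (deriv f) := by
  intro x
  obtain ⟨a, b, hax, hxb, h1⟩ := hf x
  refine ⟨Ioc a b, Ioc_mem_nhds hax hxb, ?_⟩
  have := h1.intervalIntegrable_deriv
  rwa [intervalIntegrable_iff_integrableOn_Ioc_of_le (hax.trans hxb).le] at this

theorem const_of_ae_hasDerivAt_zero {f : ℝ → X} (hf : LocallyAbsolutelyContinuous f)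
    (h0 : ∀ᵐ s, HasDerivAt f 0 s) (s t : ℝ) : f s = f t := by
  refine IsLocallyConstant.apply_eq_of_preconnectedSpace ?_ s t
  rw [IsLocallyConstant.iff_eventually_eq]
  intro x
  obtain ⟨a, b, hax, hxb, h1⟩ := hf x
  obtain ⟨C, hC⟩ := h1.const_of_ae_hasDerivAt_zero (h0.mono fun s hs _ => hs)
  rw [uIcc_of_le (hax.trans hxb).le] at hC
  filter_upwards [Icc_mem_nhds hax hxb] with y hy
  rw [hC y hy, hC x ⟨hax.le, hxb.le⟩]

/-- A locally integrable function has a locally absolutely continuous primitive. -/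
theorem of_integral {f : ℝ → ℝ} (hf : LocallyIntegrable f) (c : ℝ) :
    LocallyAbsolutelyContinuous fun s => ∫ u in c..s, f u := by
  intro x
  refine ⟨min c x - 1, max c x + 1, by linarith [min_le_right c x], by linarith [le_max_right c x],
    ?_⟩
  refine IntervalIntegrable.absolutelyContinuousOnInterval_intervalIntegral
    (intervalIntegrable_iff.2 <| (MeasureTheory.LocallyIntegrable.integrableOn_isCompact hf
      isCompact_uIcc).mono_set uIoc_subset_uIcc) ?_
  rw [uIcc_of_le (by linarith [min_le_right c x, le_max_right c x])]
  exact ⟨by linarith [min_le_left c x], by linarith [le_max_left c x]⟩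

/-- The fundamental theorem of calculus, with a derivative given almost everywhere. -/
theorem integral_eq_sub {f f' : ℝ → ℝ} (hf : LocallyAbsolutelyContinuous f)
    (h : ∀ᵐ s, HasDerivAt f (f' s) s) (a b : ℝ) : ∫ s in a..b, f' s = f b - f a := by
  have hint : LocallyIntegrable f' :=
    (hf.locallyIntegrable_deriv_real).congr (h.mono fun s hs => hs.deriv)
  have hc := (hf.sub (of_integral hint a)).const_of_ae_hasDerivAt_zero (by
    filter_upwards [h, LocallyIntegrable.ae_hasDerivAt_integral hint] with s h1 h2
    simpa using! h1.sub (h2 a)) b a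
  simp only [intervalIntegral.integral_same] at hc
  linarith

variable [FiniteDimensional ℝ X]

theorem ae_differentiableAt {f : ℝ → X} (hf : LocallyAbsolutelyContinuous f) :
    ∀ᵐ s, DifferentiableAt ℝ f s := by
  let b := Module.finBasis ℝ X
  have h : ∀ᵐ s, ∀ i, DifferentiableAt ℝ
      (fun u => LinearMap.toContinuousLinearMap (b.coord i) (f u)) s :=
    ae_all_iff.2 fun i => (hf.clm _).ae_differentiableAt_real
  filter_upwards [h] with s hs
  have : f = fun u => ∑ i, b.coord i (f u) • b i := funext fun u => (b.sum_repr (f u)).symm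
  rw [this]
  exact DifferentiableAt.fun_sum fun i _ => (hs i).smul_const _

end LocallyAbsolutelyContinuous

end LocallyAC

/-! ### Area forms and curves on the unit sphere -/

section AreaForms

variable {X : Type*} [NormedAddCommGroup X] [NormedSpace ℝ X]

/-- An area form on a plane: an alternating bilinear form satisfying Cramer's identity
`D(u,v) w + D(v,w) u + D(w,u) v = 0`. The identity encodes that the space is at most
two-dimensional; nondegeneracy is not demanded, since it follows wherever some value is nonzero. -/
structure IsAreaForm (D : X →L[ℝ] X →L[ℝ] ℝ) : Prop where
  self_eq_zero : ∀ v, D v v = 0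
  cramer : ∀ u v w, D u v • w + D v w • u + D w u • v = 0

namespace IsAreaForm

variable {D : X →L[ℝ] X →L[ℝ] ℝ} (hD : IsAreaForm D)
include hD

theorem swap (u v : X) : D u v = -D v u := by
  have h := hD.self_eq_zero (u + v)
  simp only [map_add, add_apply, hD.self_eq_zero] at h
  linarith

theorem neg : IsAreaForm (-D) where
  self_eq_zero v := by simp [hD.self_eq_zero]
  cramer u v w := by
    have h := hD.cramer u v w
    simp only [neg_apply, neg_smul]
    rw [← neg_add, ← neg_add, h, neg_zero]

theorem smul_eq (u v w : X) : D u v • w = D w v • u + D u w • v := by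
  have h := hD.cramer u v w
  rw [hD.swap v w, hD.swap w u, add_assoc, neg_smul, neg_smul] at h
  rw [eq_neg_of_add_eq_zero_left h]
  abel

/-- The Plücker relation. -/
theorem mul_eq (u v w p : X) : D u v * D w p = D w v * D u p + D u w * D v p := by
  have h := congrArg (fun q => D q p) (hD.smul_eq u v w)
  simpa using h

/-- Two vectors with vanishing area are parallel. -/
theorem eq_smul_of_eq_zero {v u u' : X} (h : D v u = 0) (h0 : D u u' ≠ 0) :
    v = (D v u' / D u u') • u := by
  have h1 := hD.smul_eq u u' v
  rw [hD.swap u v, h, neg_zero, zero_smul, add_zero] at h1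
  rw [div_eq_inv_mul, mul_smul, ← h1, smul_smul, inv_mul_cancel₀ h0, one_smul]

end IsAreaForm

/-- Every two-dimensional space carries an area form vanishing only on parallel vectors. -/
theorem exists_isAreaForm (h2 : Module.finrank ℝ X = 2) :
    ∃ D : X →L[ℝ] X →L[ℝ] ℝ, IsAreaForm D ∧ ∀ u v, D u v = 0 → u ≠ 0 → ∃ c : ℝ, v = c • u := by
  have : FiniteDimensional ℝ X := Module.finite_of_finrank_pos (by omega)
  let b := Module.finBasisOfFinrankEq ℝ X h2
  let c0 := LinearMap.toContinuousLinearMap (b.coord 0)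
  let c1 := LinearMap.toContinuousLinearMap (b.coord 1)
  have hrep : ∀ v : X, c0 v • b 0 + c1 v • b 1 = v := fun v => by
    have := b.sum_repr v
    rwa [Fin.sum_univ_two] at this
  have hval : ∀ u v, (c0.smulRight c1 - c1.smulRight c0) u v = c0 u * c1 v - c1 u * c0 v := by
    intro u v; simp
  refine ⟨c0.smulRight c1 - c1.smulRight c0, ⟨fun v => by rw [hval]; ring, fun u v w => ?_⟩,
    fun u v h hu => ?_⟩
  · rw [hval, hval, hval]
    linear_combination (norm := module) -(c0 u * c1 v - c1 u * c0 v) • hrep w -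
      (c0 v * c1 w - c1 v * c0 w) • hrep u - (c0 w * c1 u - c1 w * c0 u) • hrep v
  · rw [hval] at h
    by_cases h0 : c0 u = 0
    · have h1 : c1 u ≠ 0 := fun h1 => hu (by rw [← hrep u, h0, h1]; simp)
      have h2 : c0 v = 0 := by
        rw [h0, zero_mul, zero_sub, neg_eq_zero] at h
        exact (mul_eq_zero.1 h).resolve_left h1
      refine ⟨c1 v / c1 u, ?_⟩
      calc v = c0 v • b 0 + c1 v • b 1 := (hrep v).symm
        _ = (c1 v / c1 u) • (c0 u • b 0 + c1 u • b 1) := by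
          rw [h0, h2, smul_add, smul_smul, smul_smul, div_mul_cancel₀ _ h1, mul_zero]
        _ = _ := by rw [hrep]
    · refine ⟨c0 v / c0 u, ?_⟩
      have h3 : c1 v = c0 v / c0 u * c1 u := by field_simp; linarith
      calc v = c0 v • b 0 + c1 v • b 1 := (hrep v).symm
        _ = (c0 v / c0 u) • (c0 u • b 0 + c1 u • b 1) := by
          rw [smul_add, smul_smul, smul_smul, div_mul_cancel₀ _ h0, h3]
        _ = _ := by rw [hrep]

theorem Filter.Tendsto.area {D : X →L[ℝ] X →L[ℝ] ℝ} {α : Type*} {l : Filter α} {f g : α → X}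
    {a b : X} (hf : Tendsto f l (𝓝 a)) (hg : Tendsto g l (𝓝 b)) :
    Tendsto (fun t => D (f t) (g t)) l (𝓝 (D a b)) :=
  (D.continuous₂.tendsto (a, b)).comp (hf.prodMk_nhds hg)

theorem HasDerivWithinAt.area {D : X →L[ℝ] X →L[ℝ] ℝ} {f g : ℝ → X} {f' g' : X} {s : ℝ}
    {S : Set ℝ} (hf : HasDerivWithinAt f f' S s) (hg : HasDerivWithinAt g g' S s) :
    HasDerivWithinAt (fun u => D (f u) (g u)) (D f' (g s) + D (f s) g') S s :=
  (D.hasFDerivAt.comp_hasDerivWithinAt s hf).clm_apply hg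

theorem HasDerivAt.area {D : X →L[ℝ] X →L[ℝ] ℝ} {f g : ℝ → X} {f' g' : X} {s : ℝ}
    (hf : HasDerivAt f f' s) (hg : HasDerivAt g g' s) :
    HasDerivAt (fun u => D (f u) (g u)) (D f' (g s) + D (f s) g') s :=
  (D.hasFDerivAt.comp_hasDerivAt s hf).clm_apply hg

/-- A curve with derivative proportional to its position changes its norm at the same rate. -/
theorem HasDerivAt.norm_of_smul_self {z : ℝ → X} {s c : ℝ} (h : HasDerivAt z (c • z s) s) :
    HasDerivAt (fun u => ‖z u‖) (c * ‖z s‖) s := by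
  have h1 : HasDerivAt (fun u => (1 + (u - s) * c) * ‖z s‖) (c * ‖z s‖) s := by
    have := ((((hasDerivAt_id s).sub_const s).mul_const c).const_add 1).mul_const ‖z s‖
    simpa using this
  have h2 : HasDerivAt (fun u => ‖z u‖ - (1 + (u - s) * c) * ‖z s‖) 0 s := by
    rw [hasDerivAt_iff_isLittleO] at h ⊢
    have hpos : ∀ᶠ u in 𝓝 s, 0 < 1 + (u - s) * c := by
      have : ContinuousAt (fun u => 1 + (u - s) * c) s := by fun_prop
      exact this.eventually (lt_mem_nhds (by simp))
    refine (Asymptotics.IsBigO.of_bound 1 ?_).trans_isLittleO h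
    filter_upwards [hpos] with u hu
    have e : z u - z s - (u - s) • c • z s = z u - (1 + (u - s) * c) • z s := by module
    have e2 : (1 + (u - s) * c) * ‖z s‖ = ‖(1 + (u - s) * c) • z s‖ := by
      rw [norm_smul, Real.norm_eq_abs, abs_of_pos hu]
    rw [e, e2, one_mul]
    simp only [sub_self, zero_mul, add_zero, one_mul, smul_zero, sub_zero]
    exact abs_norm_sub_norm_le _ _
  simpa using h2.fun_add h1

/-- A `C¹` curve on the unit sphere, running in the positive direction for the area form `D`, with
locally absolutely continuous derivative `z'`. -/
structure SphereCurve (D : X →L[ℝ] X →L[ℝ] ℝ) (z z' : ℝ → X) : Prop where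
  area : IsAreaForm D
  norm_eq : ∀ s, ‖z s‖ = 1
  hasDerivAt : ∀ s, HasDerivAt z (z' s) s
  lac : LocallyAbsolutelyContinuous z'
  pos : ∀ s, 0 < D (z s) (z' s)

namespace SphereCurve

variable {D : X →L[ℝ] X →L[ℝ] ℝ} {z z' : ℝ → X} (hz : SphereCurve D z z')
include hz

protected theorem continuous : Continuous z :=
  continuous_iff_continuousAt.2 fun s => (hz.hasDerivAt s).continuousAt

theorem continuous_deriv : Continuous z' := hz.lac.continuous

theorem lac_self : LocallyAbsolutelyContinuous z :=
  .of_continuous_deriv hz.hasDerivAt hz.continuous_deriv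

theorem continuous_area : Continuous fun p : ℝ × ℝ => D (z p.1) (z' p.2) := by
  have h1 := hz.continuous
  have h2 := hz.continuous_deriv
  fun_prop

theorem lac_area : LocallyAbsolutelyContinuous fun s => D (z s) (z' s) :=
  .bilin D hz.lac_self hz.lac

/-- The position along the curve is recovered from the area function with a vector `v`, with a
Lipschitz bound. -/
theorem mul_abs_sub_le {v : X} {κ a b : ℝ} (h : ∀ u ∈ uIcc a b, κ ≤ D v (z' u)) :
    κ * |a - b| ≤ |D v (z a) - D v (z b)| := by
  wlog hab : b ≤ a generalizing a b
  · rw [abs_sub_comm, abs_sub_comm (D v (z a))]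
    exact this (by rwa [uIcc_comm]) (le_of_not_ge hab)
  rw [abs_of_nonneg (sub_nonneg.2 hab)]
  have hder : ∀ u, HasDerivAt (fun u => D v (z u)) (D v (z' u)) u := fun u =>
    (D v).hasFDerivAt.comp_hasDerivAt u (hz.hasDerivAt u)
  refine le_trans ?_ (le_abs_self _)
  have hd : Differentiable ℝ fun u => D v (z u) := fun u => (hder u).differentiableAt
  refine (convex_Icc b a).mul_sub_le_image_sub_of_le_deriv hd.continuous.continuousOn
    hd.differentiableOn (fun u hu => ?_) b ⟨le_rfl, hab⟩ a ⟨hab, le_rfl⟩ hab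
  rw [(hder u).deriv]
  rw [interior_Icc] at hu
  exact h u (by rw [uIcc_of_ge hab]; exact Ioo_subset_Icc_self hu)

/-- A vector in the sector spanned by an arc of the curve is a positive multiple of a point of that
arc. -/
theorem exists_eq_norm_smul {v : X} {a b : ℝ} (hab : a ≤ b) (ha : D v (z a) ≤ 0)
    (hb : 0 ≤ D v (z b)) (h : ∀ u ∈ Icc a b, 0 < D v (z' u)) :
    ∃ u ∈ Icc a b, 0 < ‖v‖ ∧ v = ‖v‖ • z u := by
  have hc : ContinuousOn (fun u => D v (z u)) (Icc a b) := by
    have := hz.continuous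
    fun_prop
  obtain ⟨u, hu, h0⟩ := intermediate_value_Icc hab hc ⟨ha, hb⟩
  have hpos : 0 < D v (z' u) / D (z u) (z' u) := div_pos (h u hu) (hz.pos u)
  have heq := hz.area.eq_smul_of_eq_zero h0 (hz.pos u).ne'
  have hn : ‖v‖ = D v (z' u) / D (z u) (z' u) := by
    nth_rewrite 1 [heq]
    rw [norm_smul, hz.norm_eq, mul_one, Real.norm_eq_abs, abs_of_pos hpos]
  exact ⟨u, hu, hn ▸ hpos, by rw [hn]; exact heq⟩

/-- Differentiation in the polar coordinates `v = p • z(u)` attached to the curve: if `V(t)` is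
differentiable and its angular coordinate `u` is continuous, both coordinates are differentiable,
with the derivatives read off from the area form. -/
theorem hasDerivWithinAt_polar {V : ℝ → X} {V' : X} {u p : ℝ → ℝ} {τ : ℝ} {S : Set ℝ}
    (hV : HasDerivWithinAt V V' S τ) (hu : ContinuousWithinAt u S τ) (hτ : τ ∈ S)
    (hVz : ∀ᶠ t in 𝓝[S] τ, V t = p t • z (u t)) (hp : p τ ≠ 0) :
    HasDerivWithinAt u (D (z (u τ)) V' / (p τ * D (z (u τ)) (z' (u τ)))) S τ ∧
    HasDerivWithinAt p (D V' (z' (u τ)) / D (z (u τ)) (z' (u τ))) S τ := by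
  have hw := (hz.pos (u τ)).ne'
  have hV0 : V τ = p τ • z (u τ) := hVz.self_of_nhdsWithin hτ
  have hder : HasDerivWithinAt u (D (z (u τ)) V' / (p τ * D (z (u τ)) (z' (u τ)))) S τ := by
    -- with `q = dslope z (u τ) (u t)`, the relation `D (V t) (z (u t)) = 0` gives
    -- `(u t - u τ) * D (V t) q = -D (V t - V τ) (z (u τ))`
    have hq : Tendsto (fun t => dslope z (u τ) (u t)) (𝓝[S] τ) (𝓝 (z' (u τ))) := by
      have h1 : ContinuousAt (dslope z (u τ)) (u τ) :=
        continuousAt_dslope_same.2 (hz.hasDerivAt _).differentiableAt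
      have h2 := h1.tendsto.comp hu.tendsto
      rwa [dslope_same, (hz.hasDerivAt _).deriv] at h2
    have hDq : Tendsto (fun t => D (V t) (dslope z (u τ) (u t))) (𝓝[S] τ)
        (𝓝 (D (V τ) (z' (u τ)))) :=
      Tendsto.area hV.continuousWithinAt.tendsto hq
    have hne : D (V τ) (z' (u τ)) ≠ 0 := by
      rw [hV0]; simpa using ⟨hp, hw⟩
    rw [hasDerivWithinAt_iff_tendsto_slope] at hV ⊢
    have hmono : 𝓝[S \ {τ}] τ ≤ 𝓝[S] τ := nhdsWithin_mono _ sdiff_subset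
    have hlim : Tendsto (fun t => -(D (slope V τ t) (z (u τ))) /
        D (V t) (dslope z (u τ) (u t))) (𝓝[S \ {τ}] τ)
        (𝓝 (-(D V' (z (u τ))) / D (V τ) (z' (u τ)))) := by
      refine Tendsto.div (Tendsto.neg ?_) (hDq.mono_left hmono) hne
      exact hV.area tendsto_const_nhds
    have hval : -(D V' (z (u τ))) / D (V τ) (z' (u τ)) =
        D (z (u τ)) V' / (p τ * D (z (u τ)) (z' (u τ))) := by
      rw [hz.area.swap (z (u τ)) V', hV0]; simp
    rw [← hval]
    refine hlim.congr' ?_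
    filter_upwards [hmono hVz, hmono (hDq.eventually (isOpen_ne.mem_nhds hne)),
      self_mem_nhdsWithin] with t h1 h2 h3
    have h4 : D (V t) (z (u t)) = 0 := by rw [h1]; simp [hz.area.self_eq_zero]
    have h5 : z (u t) = z (u τ) + (u t - u τ) • dslope z (u τ) (u t) := by
      rw [sub_smul_dslope]; abel
    rw [h5, map_add, map_smul, smul_eq_mul] at h4
    have h6 : D (V t - V τ) (z (u τ)) = D (V t) (z (u τ)) := by
      rw [hV0]; simp [hz.area.self_eq_zero]
    rw [slope_def_module, slope_def_field, map_smul, smul_apply, h6, smul_eq_mul, div_eq_iff h2]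
    have h7 : t - τ ≠ 0 := sub_ne_zero.2 h3.2
    field_simp
    linarith
  refine ⟨hder, ?_⟩
  have hzu := (hz.hasDerivAt (u τ)).scomp_hasDerivWithinAt τ hder
  have hc := hasDerivWithinAt_const τ S (z' (u τ))
  -- `p = D V (z' (u τ)) / D (z u) (z' (u τ))` near `τ`
  have hquot := (hV.area (D := D) hc).fun_div (hzu.area (D := D) hc) hw
  have hden : ∀ᶠ t in 𝓝[S] τ, D (z (u t)) (z' (u τ)) ≠ 0 :=
    (hzu.continuousWithinAt.tendsto.area (tendsto_const_nhds (x := z' (u τ)))).eventually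
      (isOpen_ne.mem_nhds hw)
  refine (hquot.congr_deriv ?_).congr_of_eventuallyEq ?_ ?_
  · simp only [Function.comp, map_zero, add_zero, map_smul, smul_apply, hz.area.self_eq_zero,
      smul_zero, mul_zero, sub_zero]
    field_simp
  · filter_upwards [hVz, hden] with t h1 h2
    rw [h1, map_smul, smul_apply, smul_eq_mul]
    exact (mul_div_cancel_right₀ _ h2).symm
  · simp only [Function.comp]
    rw [hV0, map_smul, smul_apply, smul_eq_mul]
    exact (mul_div_cancel_right₀ _ hw).symm

theorem hasDerivAt_polar {V : ℝ → X} {V' : X} {u p : ℝ → ℝ} {τ : ℝ}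
    (hV : HasDerivAt V V' τ) (hu : ContinuousAt u τ)
    (hVz : ∀ᶠ t in 𝓝 τ, V t = p t • z (u t)) (hp : p τ ≠ 0) :
    HasDerivAt u (D (z (u τ)) V' / (p τ * D (z (u τ)) (z' (u τ)))) τ ∧
    HasDerivAt p (D V' (z' (u τ)) / D (z (u τ)) (z' (u τ))) τ := by
  simp only [← hasDerivWithinAt_univ, ← continuousWithinAt_univ] at *
  exact hz.hasDerivWithinAt_polar hV hu (mem_univ _) (by rwa [nhdsWithin_univ]) hp

section Periodic

variable {T : ℝ} (hT : 0 < T) (hper : Function.Periodic z T)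
include hper

omit hz in
theorem _root_.Function.Periodic.deriv_of_hasDerivAt (h : ∀ s, HasDerivAt z (z' s) s) :
    Function.Periodic z' T := fun s => by
  have h1 := (h (s + T)).scomp s ((hasDerivAt_id s).add_const T)
  rw [one_smul, show z ∘ (fun x => id x + T) = z from funext hper] at h1
  exact h1.unique (h s)

include hT

/-- A uniform lower bound for the area spanned by the position and the velocity at nearby
parameters. -/
theorem exists_forall_le_area :
    ∃ δ > 0, ∃ c > 0, ∀ u v, |u - v| ≤ δ → c ≤ D (z u) (z' v) := by
  have hper' := hper.deriv_of_hasDerivAt hz.hasDerivAt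
  have hK : IsCompact (Icc (-T) (2 * T)) := isCompact_Icc
  have hw : Continuous fun s => D (z s) (z' s) :=
    hz.continuous_area.comp (continuous_id.prodMk continuous_id)
  obtain ⟨s0, -, hmin⟩ := hK.exists_isMinOn ⟨0, by constructor <;> linarith⟩ hw.continuousOn
  have hm := hz.pos s0
  set m := D (z s0) (z' s0) with hm_def
  have huc := (hK.prod hK).uniformContinuousOn_of_continuous hz.continuous_area.continuousOn
  rw [Metric.uniformContinuousOn_iff] at huc
  obtain ⟨δ, hδ, H⟩ := huc (m / 2) (by positivity)
  refine ⟨min (δ / 2) T, by positivity, m / 2, by positivity, fun u v huv => ?_⟩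
  set n := ⌊u / T⌋ with hn
  have hu0 : u - n * T ∈ Icc 0 T := by
    have h1 := Int.floor_le (u / T)
    have h2 := (Int.lt_floor_add_one (u / T)).le
    rw [le_div_iff₀ hT] at h1
    rw [div_le_iff₀ hT] at h2
    constructor <;> linarith
  have e1 : z (u - n * T) = z u := hper.sub_int_mul_eq n
  have e2 : z' (v - n * T) = z' v := hper'.sub_int_mul_eq n
  rw [← e1, ← e2]
  have hab : |(v - n * T) - (u - n * T)| ≤ min (δ / 2) T := by
    rwa [sub_sub_sub_cancel_right, abs_sub_comm]
  have hle := abs_le.1 (hab.trans (min_le_right _ _))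
  have hu1 : u - n * T ∈ Icc (-T) (2 * T) := ⟨by linarith [hu0.1], by linarith [hu0.2]⟩
  have hv1 : v - n * T ∈ Icc (-T) (2 * T) :=
    ⟨by linarith [hu0.1, hle.1], by linarith [hu0.2, hle.2]⟩
  have h3 := H (u - n * T, v - n * T) ⟨hu1, hv1⟩ (v - n * T, v - n * T) ⟨hv1, hv1⟩ (by
    rw [Prod.dist_eq, dist_self, max_eq_left dist_nonneg, Real.dist_eq, abs_sub_comm]
    linarith [hab.trans (min_le_left _ _)])
  have h4 : m ≤ D (z (v - n * T)) (z' (v - n * T)) := hmin hv1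
  rw [Real.dist_eq] at h3
  have h5 := (abs_lt.1 h3).1
  linarith

omit hT in
theorem exists_lipschitz_area (hT : T ≠ 0) :
    ∃ K, 0 < K ∧ ∀ u v, |D (z u) (z v)| ≤ K * |u - v| := by
  have hper' := hper.deriv_of_hasDerivAt hz.hasDerivAt
  obtain ⟨C, hC⟩ := (hper'.compact_of_continuous hT hz.continuous_deriv).isBounded.exists_norm_le
  have hC0 : 0 ≤ C := (norm_nonneg _).trans (hC _ (mem_range_self 0))
  refine ⟨‖D‖ * C + 1, by positivity, fun u v => ?_⟩
  have h1 : ‖z v - z u‖ ≤ C * ‖v - u‖ := convex_univ.norm_image_sub_le_of_norm_hasDerivWithin_le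
    (fun s _ => (hz.hasDerivAt s).hasDerivWithinAt) (fun s _ => hC _ (mem_range_self s))
    (mem_univ u) (mem_univ v)
  have h2 : D (z u) (z v) = D (z u) (z v - z u) := by simp [hz.area.self_eq_zero]
  rw [h2, ← Real.norm_eq_abs]
  refine (D.le_opNorm₂ _ _).trans ?_
  rw [hz.norm_eq, mul_one]
  calc ‖D‖ * ‖z v - z u‖ ≤ ‖D‖ * (C * ‖v - u‖) := by gcongr
    _ = ‖D‖ * C * |u - v| := by rw [Real.norm_eq_abs, abs_sub_comm]; ring
    _ ≤ _ := by gcongr; linarith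

end Periodic

end SphereCurve

/-- `θ s t` is a parameter between `s` and `t` at which the curve `z` points in the direction of
`z s + z t`, depending continuously on `s < t`; it is only prescribed for `s ≤ t < s + δ`. -/
structure IsBisector (z : ℝ → X) (δ : ℝ) (θ : ℝ → ℝ → ℝ) : Prop where
  mem_Icc : ∀ s t, s ≤ t → t < s + δ → θ s t ∈ Icc s t
  norm_pos : ∀ s t, s ≤ t → t < s + δ → 0 < ‖z s + z t‖
  eq_smul : ∀ s t, s ≤ t → t < s + δ → z s + z t = ‖z s + z t‖ • z (θ s t)
  continuousAt : ∀ s t, s < t → t < s + δ → ContinuousAt (fun p : ℝ × ℝ => θ p.1 p.2) (s, t)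

namespace SphereCurve

variable {D : X →L[ℝ] X →L[ℝ] ℝ} {z z' : ℝ → X} (hz : SphereCurve D z z')
include hz

/-- Bisectors exist up to any distance `δ` at which the area of position and velocity is bounded
below. The lower bound makes the angular coordinate of `z s + z t` strictly monotone along the arc,
which gives uniqueness and continuity. -/
theorem exists_isBisector {δ c : ℝ} (hc : 0 < c)
    (hδ : ∀ u v, |u - v| ≤ δ → c ≤ D (z u) (z' v)) :
    ∃ θ : ℝ → ℝ → ℝ, IsBisector z δ θ := by
  -- the value `0` chosen outside the band `s ≤ t < s + δ` is irrelevant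
  have hex : ∀ s t, ∃ u, s ≤ t → t < s + δ →
      u ∈ Icc s t ∧ 0 < ‖z s + z t‖ ∧ z s + z t = ‖z s + z t‖ • z u := by
    intro s t
    by_cases h : s ≤ t ∧ t < s + δ
    · obtain ⟨h1, h2⟩ := h
      have h0 : 0 ≤ D (z s) (z t) := by
        rcases h1.eq_or_lt with rfl | h1
        · exact (hz.area.self_eq_zero _).ge
        have hder : ∀ u, HasDerivAt (fun u => D (z s) (z u)) (D (z s) (z' u)) u := fun u =>
          (D (z s)).hasFDerivAt.comp_hasDerivAt u (hz.hasDerivAt u)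
        obtain ⟨u, hu, h3⟩ := exists_hasDerivAt_eq_slope _ _ h1
          (continuous_iff_continuousAt.2 fun u => (hder u).continuousAt).continuousOn
          (fun u _ => hder u)
        rw [hz.area.self_eq_zero, sub_zero, eq_div_iff (sub_pos.2 h1).ne'] at h3
        have h4 := hδ s u (by rw [abs_le]; constructor <;> linarith [hu.1, hu.2])
        rw [← h3]
        exact mul_nonneg (hc.le.trans h4) (sub_pos.2 h1).le
      obtain ⟨u, hu, h3⟩ := hz.exists_eq_norm_smul (v := z s + z t) h1
        (by simp [hz.area.self_eq_zero, hz.area.swap (z t), h0])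
        (by simp [hz.area.self_eq_zero, h0]) (fun u hu => by
          have h3 := hδ s u (by rw [abs_le]; constructor <;> linarith [hu.1, hu.2])
          have h4 := hδ t u (by rw [abs_le]; constructor <;> linarith [hu.1, hu.2])
          simp only [map_add, add_apply]
          linarith)
      exact ⟨u, fun _ _ => ⟨hu, h3⟩⟩
    · exact ⟨0, fun h1 h2 => absurd ⟨h1, h2⟩ h⟩
  choose θ hθ using hex
  refine ⟨θ, fun s t h1 h2 => (hθ s t h1 h2).1, fun s t h1 h2 => (hθ s t h1 h2).2.1,
    fun s t h1 h2 => (hθ s t h1 h2).2.2, fun s t h1 h2 => ?_⟩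
  obtain ⟨hm, hpos, heq⟩ := hθ s t h1.le h2
  have hV : Continuous fun p : ℝ × ℝ => D (z p.1 + z p.2) (z (θ s t)) := by
    have := hz.continuous
    fun_prop
  have hlim : Tendsto (fun p : ℝ × ℝ => |D (z p.1 + z p.2) (z (θ s t))| / c) (𝓝 (s, t)) (𝓝 0) := by
    have := ((hV.tendsto (s, t)).abs).div_const c
    have h0 : D (z s + z t) (z (θ s t)) = 0 := by
      rw [heq]; simp [hz.area.self_eq_zero]
    simpa only [h0, abs_zero, zero_div] using this
  have hev : ∀ᶠ p : ℝ × ℝ in 𝓝 (s, t), p.1 < p.2 ∧ p.2 < p.1 + δ ∧ t < p.1 + δ ∧ p.2 < s + δ := by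
    have e1 : ∀ᶠ p : ℝ × ℝ in 𝓝 (s, t), p.1 < p.2 :=
      continuousAt_fst.eventually_lt continuousAt_snd h1
    have e2 : ∀ᶠ p : ℝ × ℝ in 𝓝 (s, t), p.2 < p.1 + δ :=
      continuousAt_snd.eventually_lt (continuousAt_fst.add_const δ) h2
    have e3 : ∀ᶠ p : ℝ × ℝ in 𝓝 (s, t), t < p.1 + δ :=
      continuousAt_const.eventually_lt (continuousAt_fst.add_const δ) h2
    have e4 : ∀ᶠ p : ℝ × ℝ in 𝓝 (s, t), p.2 < s + δ :=
      continuousAt_snd.eventually_lt continuousAt_const h2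
    filter_upwards [e1, e2, e3, e4] with p h3 h4 h5 h6 using ⟨h3, h4, h5, h6⟩
  refine tendsto_iff_dist_tendsto_zero.2 (squeeze_zero' (Eventually.of_forall fun _ => dist_nonneg)
    ?_ hlim)
  filter_upwards [hev] with p ⟨h3, h4, h5, h6⟩
  obtain ⟨hm', hpos', heq'⟩ := hθ p.1 p.2 h3.le h4
  have h7 : D (z p.1 + z p.2) (z (θ p.1 p.2)) = 0 := by
    rw [heq']; simp [hz.area.self_eq_zero]
  have := hz.mul_abs_sub_le (v := z p.1 + z p.2) (κ := c) (a := θ p.1 p.2) (b := θ s t) ?_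
  · rw [h7, zero_sub, abs_neg] at this
    rw [le_div_iff₀ hc, Real.dist_eq, mul_comm]
    exact this
  · intro u hu
    have hu1 : min p.1 s ≤ u := (le_min ((min_le_left _ _).trans hm'.1)
      ((min_le_right _ _).trans hm.1)).trans hu.1
    have hu2 : u ≤ max p.2 t := hu.2.trans (max_le (hm'.2.trans (le_max_left _ _))
      (hm.2.trans (le_max_right _ _)))
    have h8 : |p.1 - u| ≤ δ ∧ |p.2 - u| ≤ δ := by
      rcases min_cases p.1 s with ⟨e1, _⟩ | ⟨e1, _⟩ <;>
      rcases max_cases p.2 t with ⟨e2, _⟩ | ⟨e2, _⟩ <;>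
      rw [e1] at hu1 <;> rw [e2] at hu2 <;> constructor <;> rw [abs_le] <;> constructor <;> linarith
    have h9 := hδ _ _ h8.1
    have h10 := hδ _ _ h8.2
    simp only [map_add, add_apply]
    linarith

end SphereCurve

end AreaForms

/-! ### Differential calculus of the bisector -/

section Bisector

variable {X : Type*} [NormedAddCommGroup X] [NormedSpace ℝ X]

/-- Second-order symmetric Taylor expansion, phrased as a one-sided derivative in the squared
step `κ`. -/
theorem hasDerivWithinAt_symm_sum {z z' : ℝ → X} {z'' : X} {m : ℝ}
    (hz : ∀ s, HasDerivAt z (z' s) s) (hm : HasDerivAt z' z'' m) :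
    HasDerivWithinAt (fun κ => z (m - √κ) + z (m + √κ)) z'' (Ici 0) 0 := by
  rw [hasDerivWithinAt_iff_isLittleO, Asymptotics.isLittleO_iff]
  intro ε hε
  rw [hasDerivAt_iff_isLittleO, Asymptotics.isLittleO_iff] at hm
  have h1 := hm (c := ε / 2) (by positivity)
  rw [Metric.eventually_nhds_iff] at h1
  obtain ⟨ρ, hρ, H⟩ := h1
  have hev : ∀ᶠ κ in 𝓝[Ici 0] (0 : ℝ), κ ∈ Ico 0 (ρ ^ 2) :=
    Ico_mem_nhdsGE (by positivity)
  filter_upwards [hev] with κ hκ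
  set h := √κ with hh
  have hκh : κ = h ^ 2 := (Real.sq_sqrt hκ.1).symm
  have h0 : 0 ≤ h := Real.sqrt_nonneg _
  have hlt : h < ρ := by
    rw [hκh] at hκ
    exact lt_of_pow_lt_pow_left₀ 2 hρ.le hκ.2
  -- the remainder `ψ` has derivative `o(k)`
  set ψ : ℝ → X := fun k => z (m - k) + z (m + k) - k ^ 2 • z'' with hψ
  have hder : ∀ k, HasDerivAt ψ (-z' (m - k) + z' (m + k) - (2 * k) • z'') k := by
    intro k
    have e1 := (hz (m - k)).scomp k ((hasDerivAt_id k).const_sub m)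
    have e2 := (hz (m + k)).scomp k ((hasDerivAt_id k).const_add m)
    have e3 := (hasDerivAt_pow 2 k).smul_const z''
    have := (e1.add e2).sub e3
    simpa [hψ] using! this
  have hb : ∀ k ∈ Icc 0 h, ‖-z' (m - k) + z' (m + k) - (2 * k) • z''‖ ≤ ε * h := by
    intro k hk
    have e1 := H (y := m + k) (by rw [Real.dist_eq]; simp [abs_of_nonneg hk.1]; linarith [hk.2])
    have e2 := H (y := m - k) (by rw [Real.dist_eq]; simp [abs_of_nonneg hk.1]; linarith [hk.2])
    rw [show m + k - m = k by ring, Real.norm_eq_abs, abs_of_nonneg hk.1] at e1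
    rw [show m - k - m = -k by ring, Real.norm_eq_abs, abs_neg, abs_of_nonneg hk.1] at e2
    have e3 : -z' (m - k) + z' (m + k) - (2 * k) • z'' =
      (z' (m + k) - z' m - k • z'') - (z' (m - k) - z' m - (-k) • z'') := by module
    rw [e3]
    calc _ ≤ _ := norm_sub_le _ _
      _ ≤ ε / 2 * k + ε / 2 * k := add_le_add e1 e2
      _ = ε * k := by ring
      _ ≤ ε * h := by gcongr; exact hk.2
  have hmv := (convex_Icc 0 h).norm_image_sub_le_of_norm_hasDerivWithin_le
    (fun k _ => (hder k).hasDerivWithinAt) hb ⟨le_rfl, h0⟩ ⟨h0, le_rfl⟩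
  have e4 : z (m - h) + z (m + h) - (z (m - √0) + z (m + √0)) - (κ - 0) • z'' = ψ h - ψ 0 := by
    simp only [hψ, hκh, Real.sqrt_zero]
    module
  rw [e4]
  refine hmv.trans (le_of_eq ?_)
  rw [sub_zero, sub_zero, hκh, Real.norm_eq_abs, Real.norm_eq_abs, abs_of_nonneg h0,
    abs_of_nonneg (sq_nonneg h)]
  ring

namespace SphereCurve

variable {D : X →L[ℝ] X →L[ℝ] ℝ} {z z' : ℝ → X} (hz : SphereCurve D z z')
  {δ : ℝ} {θ : ℝ → ℝ → ℝ} (hθ : IsBisector z δ θ)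
include hz hθ

theorem hasDerivAt_norm_add_left {s t : ℝ} (h1 : s < t) (h2 : t < s + δ) :
    HasDerivAt (fun s => ‖z s + z t‖) (D (z' s) (z' (θ s t)) / D (z (θ s t)) (z' (θ s t))) s := by
  have hc : ContinuousAt (fun s => θ s t) s :=
    (hθ.continuousAt s t h1 h2).comp (f := fun s => (s, t)) (by fun_prop)
  have hev : ∀ᶠ s' in 𝓝 s, s' < t ∧ t < s' + δ := by
    filter_upwards [Ioo_mem_nhds (show t - δ < s by linarith) h1] with s' hs'
    exact ⟨hs'.2, by linarith [hs'.1]⟩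
  refine (hz.hasDerivAt_polar ((hz.hasDerivAt s).add_const (z t)) hc ?_
    (hθ.norm_pos s t h1.le h2).ne').2
  filter_upwards [hev] with s' hs'
  exact hθ.eq_smul s' t hs'.1.le hs'.2

theorem hasDerivAt_bisector_right {s t : ℝ} (h1 : s < t) (h2 : t < s + δ) :
    HasDerivAt (fun t => θ s t)
      (D (z (θ s t)) (z' t) / (‖z s + z t‖ * D (z (θ s t)) (z' (θ s t)))) t := by
  have hc : ContinuousAt (fun t => θ s t) t :=
    (hθ.continuousAt s t h1 h2).comp (f := fun t => (s, t)) (by fun_prop)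
  refine (hz.hasDerivAt_polar (p := fun t => ‖z s + z t‖) ((hz.hasDerivAt t).const_add (z s)) hc ?_
    (hθ.norm_pos s t h1.le h2).ne').1
  filter_upwards [Ioo_mem_nhds h1 h2] with t' ht'
  exact hθ.eq_smul s t' ht'.1.le ht'.2

theorem hasDerivAt_bisector_symm {σ η : ℝ} (h1 : 0 < η) (h2 : 2 * η < δ) :
    HasDerivAt (fun σ => θ (σ - η) (σ + η))
      (D (z (θ (σ - η) (σ + η))) (z' (σ - η) + z' (σ + η)) /
        (‖z (σ - η) + z (σ + η)‖ * D (z (θ (σ - η) (σ + η))) (z' (θ (σ - η) (σ + η))))) σ := by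
  have hc : ContinuousAt (fun σ => θ (σ - η) (σ + η)) σ :=
    (hθ.continuousAt (σ - η) (σ + η) (by linarith) (by linarith)).comp
      (f := fun σ => (σ - η, σ + η)) (by fun_prop)
  have e1 := (hz.hasDerivAt (σ - η)).comp_sub_const σ η
  have e2 := (hz.hasDerivAt (σ + η)).comp_add_const σ η
  refine (hz.hasDerivAt_polar (p := fun σ => ‖z (σ - η) + z (σ + η)‖) (e1.add e2) hc ?_
    (hθ.norm_pos _ _ (by linarith) (by linarith)).ne').1
  exact Eventually.of_forall fun σ' => hθ.eq_smul _ _ (by linarith) (by linarith)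

/-- The mixed second derivative of `‖z s + z t‖`; it exists as soon as `z'` is differentiable at
the bisecting parameter. -/
theorem hasDerivAt_mixed {s t : ℝ} {z'' : X} (h1 : s < t) (h2 : t < s + δ)
    (hd : HasDerivAt z' z'' (θ s t)) :
    HasDerivAt (fun t => D (z' s) (z' (θ s t)) / D (z (θ s t)) (z' (θ s t)))
      (D (z' (θ s t)) z'' / D (z (θ s t)) (z' (θ s t)) *
        (D (z (θ s t)) (z' s) / D (z (θ s t)) (z' (θ s t))) *
        (D (z (θ s t)) (z' t) / (‖z s + z t‖ * D (z (θ s t)) (z' (θ s t))))) t := by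
  have hθt := hz.hasDerivAt_bisector_right hθ h1 h2
  set u := θ s t with hu
  have hw := (hz.pos u).ne'
  -- the derivative in `v` of `D (z' s) (z' v) / D (z v) (z' v)`, by the Plücker relation
  have key : HasDerivAt (fun v => D (z' s) (z' v) / D (z v) (z' v))
      (D (z' u) z'' / D (z u) (z' u) * (D (z u) (z' s) / D (z u) (z' u))) u := by
    have n1 := (hasDerivAt_const u (z' s)).area (D := D) hd
    have n2 := (hz.hasDerivAt u).area (D := D) hd
    refine (n1.fun_div n2 hw).congr_deriv ?_
    have hp := hz.area.mul_eq (z u) (z' u) z'' (z' s)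
    rw [hz.area.swap z'' (z' u), hz.area.swap z'' (z' s), hz.area.swap (z' u) (z' s)] at hp
    simp only [map_zero, zero_apply, zero_add, hz.area.self_eq_zero]
    field_simp
    linarith
  exact key.comp t hθt

end SphereCurve

theorem IsBisector.self_eq {z : ℝ → X} {δ : ℝ} {θ : ℝ → ℝ → ℝ} (hθ : IsBisector z δ θ)
    (hδ : 0 < δ) (m : ℝ) : θ m m = m := by
  have := hθ.mem_Icc m m le_rfl (by linarith)
  rwa [Icc_self, mem_singleton_iff] at this

namespace SphereCurve

variable {D : X →L[ℝ] X →L[ℝ] ℝ} {z z' : ℝ → X} (hz : SphereCurve D z z')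
  {δ : ℝ} {θ : ℝ → ℝ → ℝ} (hθ : IsBisector z δ θ)
include hz hθ

/-- Second-order expansions, in the half-distance, of the bisector and of `‖z s + z t‖` near the
diagonal; `κ` is the squared half-distance. -/
theorem hasDerivWithinAt_near_diagonal (hδ : 0 < δ) {m : ℝ} {z'' : X}
    (hm : HasDerivAt z' z'' m) :
    HasDerivWithinAt (fun κ => θ (m - √κ) (m + √κ))
      (D (z m) z'' / (2 * D (z m) (z' m))) (Ici 0) 0 ∧
    HasDerivWithinAt (fun κ => ‖z (m - √κ) + z (m + √κ)‖)
      (D z'' (z' m) / D (z m) (z' m)) (Ici 0) 0 := by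
  have hV := hasDerivWithinAt_symm_sum hz.hasDerivAt hm
  have hself := hθ.self_eq hδ m
  have hev : ∀ᶠ κ in 𝓝[Ici 0] (0 : ℝ), m + √κ < m - √κ + δ := by
    refine eventually_nhdsWithin_of_eventually_nhds ?_
    have : ContinuousAt (fun κ : ℝ => δ - 2 * √κ) 0 := by fun_prop
    filter_upwards [this.eventually (lt_mem_nhds (show 0 < δ - 2 * √0 by simpa using hδ))] with κ hκ
    linarith
  have hc : ContinuousWithinAt (fun κ => θ (m - √κ) (m + √κ)) (Ici 0) 0 := by
    have l1 : Tendsto (fun κ : ℝ => m - √κ) (𝓝[Ici 0] 0) (𝓝 m) := by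
      have : ContinuousAt (fun κ : ℝ => m - √κ) 0 := by fun_prop
      simpa using this.tendsto.mono_left nhdsWithin_le_nhds
    have l2 : Tendsto (fun κ : ℝ => m + √κ) (𝓝[Ici 0] 0) (𝓝 m) := by
      have : ContinuousAt (fun κ : ℝ => m + √κ) 0 := by fun_prop
      simpa using this.tendsto.mono_left nhdsWithin_le_nhds
    have h0 : θ (m - √0) (m + √0) = m := by simpa using hself
    rw [ContinuousWithinAt, h0]
    refine tendsto_of_tendsto_of_tendsto_of_le_of_le' l1 l2 ?_ ?_
    · filter_upwards [hev] with κ hκ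
      exact (hθ.mem_Icc _ _ (by linarith [Real.sqrt_nonneg κ]) hκ).1
    · filter_upwards [hev] with κ hκ
      exact (hθ.mem_Icc _ _ (by linarith [Real.sqrt_nonneg κ]) hκ).2
  have h2 : ‖z (m - √0) + z (m + √0)‖ = 2 := by
    rw [Real.sqrt_zero, sub_zero, add_zero, ← two_smul ℝ, norm_smul, hz.norm_eq]; norm_num
  have := hz.hasDerivWithinAt_polar (p := fun κ => ‖z (m - √κ) + z (m + √κ)‖) hV hc
    (self_mem_Ici) ?_ (by rw [h2]; norm_num)
  · simp only [Real.sqrt_zero, sub_zero, add_zero, hself] at this h2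
    rwa [h2] at this
  · filter_upwards [hev] with κ hκ
    exact hθ.eq_smul _ _ (by linarith [Real.sqrt_nonneg κ]) hκ

end SphereCurve

end Bisector

/-! ### Increasing changes of variable -/

section ChangeOfVariable

theorem HasDerivWithinAt.nonneg_of_eventually_le {f : ℝ → ℝ} {f' a : ℝ}
    (hf : HasDerivWithinAt f f' (Ici a) a) (h : ∀ᶠ t in 𝓝[>] a, f a ≤ f t) : 0 ≤ f' := by
  rw [hasDerivWithinAt_iff_tendsto_slope, Ici_sdiff_left] at hf
  refine ge_of_tendsto hf ?_
  filter_upwards [h, self_mem_nhdsWithin] with t h1 h2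
  rw [slope_def_field]
  exact div_nonneg (sub_nonneg.2 h1) (sub_pos.2 h2).le

variable {φ φ' : ℝ → ℝ} (hφ : ∀ s, HasDerivAt φ (φ' s) s) (hpos : ∀ s, 0 < φ' s)
include hφ hpos

/-- Preimages of null sets under a change of variable with positive derivative are null. -/
theorem ae_comp_of_hasDerivAt_pos {Q : ℝ → Prop} (hQ : ∀ᵐ u, Q u) : ∀ᵐ s, Q (φ s) := by
  have hinj := (strictMono_of_hasDerivAt_pos (f := φ) hφ hpos).injective
  have hφc : Continuous φ := continuous_iff_continuousAt.2 fun s => (hφ s).continuousAt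
  set N := toMeasurable volume {u | ¬ Q u} with hN
  have hN0 : volume N = 0 := by rw [hN, measure_toMeasurable]; exact hQ
  have hNm : MeasurableSet N := measurableSet_toMeasurable _ _
  -- the integral of `φ'` over the preimage of a measurable null set `N` is at most the
  -- measure of `N`
  have h1 := lintegral_image_eq_lintegral_abs_deriv_mul (s := univ) MeasurableSet.univ
    (fun s _ => (hφ s).hasDerivWithinAt) hinj.injOn (N.indicator 1)
  have h2 : ∫⁻ u in φ '' univ, N.indicator 1 u = 0 := by
    refine le_antisymm ?_ zero_le
    calc _ ≤ ∫⁻ u, N.indicator 1 u := setLIntegral_le_lintegral _ _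
      _ = 0 := by rw [lintegral_indicator_one hNm, hN0]
  have hm : Measurable φ' := by
    rw [show φ' = deriv φ from funext fun s => (hφ s).deriv.symm]
    exact measurable_deriv φ
  rw [h2, Measure.restrict_univ, eq_comm, lintegral_eq_zero_iff] at h1
  · filter_upwards [h1] with s hs
    by_contra hQs
    have hmem : φ s ∈ N := subset_toMeasurable _ _ hQs
    have := hpos s
    simp [hmem, abs_of_pos this] at hs
    linarith
  · exact (hm.abs.ennreal_ofReal).mul ((measurable_one.indicator hNm).comp hφc.measurable)

theorem integral_comp_of_hasDerivAt_pos {S : ℝ → ℝ} (hS : LocallyIntegrable S) {a b : ℝ}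
    (hab : a ≤ b) :
    IntervalIntegrable (fun s => φ' s * S (φ s)) volume a b ∧
    ∫ s in a..b, φ' s * S (φ s) = ∫ u in φ a..φ b, S u := by
  have hmono := strictMono_of_hasDerivAt_pos (f := φ) hφ hpos
  have hφc : Continuous φ := continuous_iff_continuousAt.2 fun s => (hφ s).continuousAt
  have himg : φ '' Icc a b = Icc (φ a) (φ b) := by
    refine Subset.antisymm ?_ (intermediate_value_Icc hab hφc.continuousOn)
    rintro _ ⟨s, hs, rfl⟩
    exact ⟨hmono.monotone hs.1, hmono.monotone hs.2⟩
  have h1 := integrableOn_image_iff_integrableOn_deriv_smul_of_monotoneOn (s := Icc a b)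
    measurableSet_Icc (fun s _ => (hφ s).hasDerivWithinAt) (hmono.monotone.monotoneOn _) S
  have h2 := integral_image_eq_integral_deriv_smul_of_monotoneOn (s := Icc a b)
    measurableSet_Icc (fun s _ => (hφ s).hasDerivWithinAt) (hmono.monotone.monotoneOn _) S
  rw [himg] at h1 h2
  constructor
  · rw [intervalIntegrable_iff_integrableOn_Icc_of_le hab]
    exact h1.1 (hS.integrableOn_isCompact isCompact_Icc)
  · rw [intervalIntegral.integral_of_le hab, intervalIntegral.integral_of_le (hmono.monotone hab),
      ← integral_Icc_eq_integral_Ioc, ← integral_Icc_eq_integral_Ioc, h2]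
    rfl

end ChangeOfVariable

/-! ### Two curves with the same metric -/

section Pair

variable {X : Type*} [NormedAddCommGroup X] [NormedSpace ℝ X]
variable {Y : Type*} [NormedAddCommGroup Y] [NormedSpace ℝ Y]

namespace SphereCurve

/-- The curvature density, the coefficient of `-z` in `z''`, is nonnegative, because
`‖z (m - η) + z (m + η)‖` is largest at `η = 0`. -/
theorem curvature_nonneg {D : X →L[ℝ] X →L[ℝ] ℝ} {z z' : ℝ → X} (hz : SphereCurve D z z')
    {δ : ℝ} {θ : ℝ → ℝ → ℝ} (hθ : IsBisector z δ θ) (hδ : 0 < δ) {m : ℝ} {z'' : X}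
    (hm : HasDerivAt z' z'' m) : 0 ≤ D (z' m) z'' / D (z m) (z' m) := by
  have h1 := ((hz.hasDerivWithinAt_near_diagonal hθ hδ hm).2.neg).nonneg_of_eventually_le
    (Eventually.of_forall fun t => ?_)
  · rwa [hz.area.swap, neg_div, neg_neg] at h1
  · refine neg_le_neg ((norm_add_le _ _).trans (le_of_eq ?_))
    simp only [Real.sqrt_zero, sub_zero, add_zero, hz.norm_eq]
    rw [← two_smul ℝ (z m), norm_smul, hz.norm_eq]
    norm_num

/-- The curvature density is locally integrable. -/
theorem locallyIntegrable_curvature [FiniteDimensional ℝ X] {D : X →L[ℝ] X →L[ℝ] ℝ} {z z' : ℝ → X}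
    (hz : SphereCurve D z z') : LocallyIntegrable fun s => D (z' s) (deriv z' s) := by
  have hcomp : ∀ p : X, LocallyIntegrable fun s => D p (deriv z' s) := by
    intro p
    refine ((hz.lac.clm (D p)).locallyIntegrable_deriv_real).congr ?_
    filter_upwards [hz.lac.ae_differentiableAt] with s hs
    exact ((D p).hasFDerivAt.comp_hasDerivAt s hs.hasDerivAt).deriv
  -- expand the area in the basis `z 0`, `z' 0`, with fixed vectors paired against `z''`
  have h0 := (hz.pos 0).ne'
  have hc := hz.continuous_deriv
  have h1 := (hcomp (z' 0)).continuous_mul (g := fun s => D (z 0) (z' s)) (by fun_prop)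
  have h2 := (hcomp (z 0)).continuous_mul (g := fun s => D (z' 0) (z' s)) (by fun_prop)
  have h3 := (h1.sub h2).smul (D (z 0) (z' 0))⁻¹
  refine h3.congr (Eventually.of_forall fun s => ?_)
  have h4 := hz.area.mul_eq (z 0) (z' 0) (z' s) (deriv z' s)
  rw [hz.area.swap (z' s) (z' 0)] at h4
  simp only [Pi.smul_apply, Pi.sub_apply, smul_eq_mul]
  field_simp
  linarith

end SphereCurve

/-- Two periodic curves on the unit spheres of two planes, traversed isometrically and compatibly
with antipodes, the first parametrized by twice the area of the sector it sweeps out. Then `x`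
solves a Hill equation `x'' = -e x`. -/
structure HillPair (DX : X →L[ℝ] X →L[ℝ] ℝ) (DY : Y →L[ℝ] Y →L[ℝ] ℝ) (x x' : ℝ → X) (y y' : ℝ → Y)
    (T : ℝ) : Prop where
  left : SphereCurve DX x x'
  right : SphereCurve DY y y'
  area_eq_one : ∀ s, DX (x s) (x' s) = 1
  pos : 0 < T
  periodic_left : Function.Periodic x T
  periodic_right : Function.Periodic y T
  norm_sub : ∀ s t, ‖x s - x t‖ = ‖y s - y t‖
  norm_add : ∀ s t, ‖x s + x t‖ = ‖y s + y t‖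

namespace HillPair

variable {DX : X →L[ℝ] X →L[ℝ] ℝ} {DY : Y →L[ℝ] Y →L[ℝ] ℝ} {x x' : ℝ → X} {y y' : ℝ → Y} {T : ℝ}
  (h : HillPair DX DY x x' y y' T)
include h

theorem exists_forall_le_area : ∃ δ > 0, ∃ c > 0,
    (∀ u v, |u - v| ≤ δ → c ≤ DX (x u) (x' v)) ∧ (∀ u v, |u - v| ≤ δ → c ≤ DY (y u) (y' v)) := by
  obtain ⟨δ1, hδ1, c1, hc1, H1⟩ := h.left.exists_forall_le_area h.pos h.periodic_left
  obtain ⟨δ2, hδ2, c2, hc2, H2⟩ := h.right.exists_forall_le_area h.pos h.periodic_right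
  exact ⟨min δ1 δ2, lt_min hδ1 hδ2, min c1 c2, lt_min hc1 hc2,
    fun u v huv => (min_le_left _ _).trans (H1 u v (huv.trans (min_le_left _ _))),
    fun u v huv => (min_le_right _ _).trans (H2 u v (huv.trans (min_le_right _ _)))⟩

/-- In the area parametrization the acceleration is radial: Hill's equation `x'' = -e x`. -/
theorem hill {m : ℝ} {x'' : X} (hx : HasDerivAt x' x'' m) :
    DX (x m) x'' = 0 ∧ x'' = -DX (x' m) x'' • x m := by
  have h1 := (h.left.hasDerivAt m).area (D := DX) hx
  rw [show (fun u => DX (x u) (x' u)) = fun _ => 1 from funext h.area_eq_one,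
    h.left.area.self_eq_zero, zero_add] at h1
  have h2 := h1.unique (hasDerivAt_const m 1)
  refine ⟨h2, ?_⟩
  have h3 := h.left.area.smul_eq (x m) (x' m) x''
  rwa [h.area_eq_one, one_smul, h2, zero_smul, add_zero, h.left.area.swap] at h3

variable {δ : ℝ} {θ χ : ℝ → ℝ → ℝ} (hθ : IsBisector x δ θ) (hχ : IsBisector y δ χ)
include hθ hχ

/-- The two curves have the same curvature: for both it is the coefficient of `-η²` in the expansion
of `‖x (m - η) + x (m + η)‖ = ‖y (m - η) + y (m + η)‖` at `η = 0`. -/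
theorem curvature_eq (hδ : 0 < δ) {m : ℝ} {x'' : X} {y'' : Y}
    (hx : HasDerivAt x' x'' m) (hy : HasDerivAt y' y'' m) :
    DX (x' m) x'' = DY (y' m) y'' / DY (y m) (y' m) := by
  have h1 := (h.left.hasDerivWithinAt_near_diagonal hθ hδ hx).2
  have h2 := (h.right.hasDerivWithinAt_near_diagonal hχ hδ hy).2
  simp only [← h.norm_add] at h2
  have h3 := (uniqueDiffOn_Ici (0 : ℝ) 0 self_mem_Ici).eq_deriv _ h1 h2
  rw [h.area_eq_one, div_one, h.left.area.swap, h.right.area.swap, neg_div] at h3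
  exact neg_injective h3

/-- Equality of the mixed second derivatives of `‖x s + x t‖ = ‖y s + y t‖`. -/
theorem mixed_eq {s t : ℝ} (h1 : s < t) (h2 : t < s + δ) {x'' : X} {y'' : Y}
    (hx : HasDerivAt x' x'' (θ s t)) (hy : HasDerivAt y' y'' (χ s t)) :
    DX (x' (θ s t)) x'' * DX (x (θ s t)) (x' s) * DX (x (θ s t)) (x' t) =
      DY (y' (χ s t)) y'' / DY (y (χ s t)) (y' (χ s t)) *
        (DY (y (χ s t)) (y' s) / DY (y (χ s t)) (y' (χ s t))) *
        (DY (y (χ s t)) (y' t) / DY (y (χ s t)) (y' (χ s t))) := by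
  have e1 := h.left.hasDerivAt_mixed hθ h1 h2 hx
  have e2 := h.right.hasDerivAt_mixed hχ h1 h2 hy
  have e3 : (fun t => DX (x' s) (x' (θ s t)) / DX (x (θ s t)) (x' (θ s t))) =ᶠ[𝓝 t]
      fun t => DY (y' s) (y' (χ s t)) / DY (y (χ s t)) (y' (χ s t)) := by
    filter_upwards [Ioo_mem_nhds h1 h2] with t' ht'
    have n1 := h.left.hasDerivAt_norm_add_left hθ ht'.1 ht'.2
    have n2 := h.right.hasDerivAt_norm_add_left hχ ht'.1 ht'.2
    simp only [← h.norm_add] at n2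
    exact n1.unique n2
  have e4 := e1.unique (e2.congr_of_eventuallyEq e3)
  have hP := (hθ.norm_pos s t h1.le h2).ne'
  rw [← h.norm_add] at e4
  simp only [h.area_eq_one, div_one, mul_one] at e4
  have hw := (h.right.pos (χ s t)).ne'
  field_simp at e4 ⊢
  linarith

/-- Pointwise comparison of the speeds of the two bisectors, weighted by the square root `S` of the
curvature. It is the inequality of arithmetic and geometric means, applied to the two partial
derivatives of each bisector; `ε` bounds the relative imbalance of those derivatives for `x`. -/
theorem speed_le {s t : ℝ} (hδ : 0 < δ) (h1 : s < t) (h2 : t < s + δ) {x'' x1 : X} {y'' : Y}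
    (hx : HasDerivAt x' x'' (θ s t)) (hy : HasDerivAt y' y'' (χ s t))
    (hx1 : HasDerivAt x' x1 (χ s t))
    (ps : 0 < DX (x (θ s t)) (x' s)) (pt : 0 < DX (x (θ s t)) (x' t))
    (qs : 0 < DY (y (χ s t)) (y' s)) (qt : 0 < DY (y (χ s t)) (y' t)) {ε : ℝ} (hε0 : 0 ≤ ε)
    (hε1 : ε ≤ 1) (hε : |DX (x (θ s t)) (x' t - x' s)| ≤ ε * DX (x (θ s t)) (x' s + x' t)) :
    (1 - ε ^ 2) * (√(DX (x' (θ s t)) x'') * DX (x (θ s t)) (x' s + x' t)) ≤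
      √(DX (x' (χ s t)) x1) *
        (DY (y (χ s t)) (y' s + y' t) / DY (y (χ s t)) (y' (χ s t))) := by
  have e1 := h.mixed_eq hθ hχ h1 h2 hx hy
  rw [← h.curvature_eq hθ hχ hδ hx1 hy] at e1
  have hEx : 0 ≤ DX (x' (θ s t)) x'' := by
    simpa [h.area_eq_one] using h.left.curvature_nonneg hθ hδ hx
  have hEy : 0 ≤ DX (x' (χ s t)) x1 := by
    simpa [h.area_eq_one] using h.left.curvature_nonneg hθ hδ hx1
  have hw := h.right.pos (χ s t)
  rw [map_add (DY _), add_div]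
  simp only [map_add, map_sub] at hε ⊢
  generalize DX (x' (χ s t)) x1 = Ey at *
  generalize DX (x' (θ s t)) x'' = Ex at *
  generalize DX (x (θ s t)) (x' s) = a at *
  generalize DX (x (θ s t)) (x' t) = b at *
  have qs' := div_pos qs hw
  have qt' := div_pos qt hw
  generalize DY (y (χ s t)) (y' s) / DY (y (χ s t)) (y' (χ s t)) = p at *
  generalize DY (y (χ s t)) (y' t) / DY (y (χ s t)) (y' (χ s t)) = q at *
  refine le_of_abs_le (abs_le_of_sq_le_sq ?_ (by positivity))
  have hsx := Real.sq_sqrt hEx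
  have hsy := Real.sq_sqrt hEy
  have hε2 : (b - a) ^ 2 ≤ ε ^ 2 * (a + b) ^ 2 := by
    rw [← sq_abs, ← mul_pow]
    exact pow_le_pow_left₀ (abs_nonneg _) hε 2
  have hκ : ε ^ 2 ≤ 1 := pow_le_one₀ hε0 hε1
  calc ((1 - ε ^ 2) * (√Ex * (a + b))) ^ 2
      = (1 - ε ^ 2) ^ 2 * (Ex * (a + b) ^ 2) := by rw [mul_pow, mul_pow, hsx]
    _ ≤ (1 - ε ^ 2) * (Ex * (a + b) ^ 2) := by
        refine mul_le_mul_of_nonneg_right ?_ (by positivity)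
        nlinarith [sq_nonneg ε]
    _ = Ex * ((a + b) ^ 2 - ε ^ 2 * (a + b) ^ 2) := by ring
    _ ≤ Ex * ((a + b) ^ 2 - (b - a) ^ 2) := by gcongr
    _ = 4 * (Ex * a * b) := by ring
    _ = 4 * (Ey * p * q) := by rw [e1]
    _ ≤ Ey * (p + q) ^ 2 := by nlinarith [mul_nonneg hEy (sq_nonneg (p - q))]
    _ = (√Ey * (p + q)) ^ 2 := by rw [mul_pow, hsy]

end HillPair

end Pair

/-! ### Integrated comparison of bisectors -/

section Rigidity

variable {X : Type*} [NormedAddCommGroup X] [NormedSpace ℝ X]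
variable {Y : Type*} [NormedAddCommGroup Y] [NormedSpace ℝ Y]

theorem MeasureTheory.LocallyIntegrable.intervalIntegrable_real {f : ℝ → ℝ} (hf : LocallyIntegrable f)
    (a b : ℝ) : IntervalIntegrable f volume a b :=
  intervalIntegrable_iff.2 ((hf.integrableOn_isCompact isCompact_uIcc).mono_set uIoc_subset_uIcc)

/-- Integrals of a locally integrable function over short intervals are uniformly small. -/
theorem MeasureTheory.LocallyIntegrable.exists_forall_integral_le {f : ℝ → ℝ}
    (hf : LocallyIntegrable f) (a b : ℝ) {ε : ℝ} (hε : 0 < ε) :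
    ∃ ρ > 0, ∀ σ ∈ Icc a b, ∀ η, 0 ≤ η → η < ρ → ∫ u in (σ - η)..(σ + η), f u ≤ ε := by
  have hint := hf.intervalIntegrable_real
  have hc : Continuous fun s => ∫ u in (0 : ℝ)..s, f u :=
    intervalIntegral.continuous_primitive hint 0
  have huc := (isCompact_Icc (a := a - 1) (b := b + 1)).uniformContinuousOn_of_continuous
    hc.continuousOn
  rw [Metric.uniformContinuousOn_iff] at huc
  obtain ⟨ρ, hρ, H⟩ := huc ε hε
  refine ⟨min 1 (ρ / 2), by positivity, fun σ hσ η h0 hη => ?_⟩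
  have h1 := hη.trans_le (min_le_left _ _)
  have h2 := hη.trans_le (min_le_right _ _)
  have h3 := H (σ + η) ⟨by linarith [hσ.1], by linarith [hσ.2]⟩ (σ - η)
    ⟨by linarith [hσ.1], by linarith [hσ.2]⟩ (by
      rw [Real.dist_eq, show σ + η - (σ - η) = 2 * η by ring, abs_of_nonneg (by linarith)]
      linarith)
  rw [Real.dist_eq, intervalIntegral.integral_interval_sub_left (hint _ _) (hint _ _)] at h3
  exact (le_abs_self _).trans h3.le

namespace HillPair

variable {DX : X →L[ℝ] X →L[ℝ] ℝ} {DY : Y →L[ℝ] Y →L[ℝ] ℝ} {x x' : ℝ → X} {y y' : ℝ → Y} {T : ℝ}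
  (h : HillPair DX DY x x' y y' T)
include h

variable [FiniteDimensional ℝ X]

/-- Along a short arc the partial derivatives of the bisector of `x` are almost equal: this is
where the area parametrization is needed. -/
theorem abs_area_sub_le {δ : ℝ} {θ : ℝ → ℝ → ℝ} (hθ : IsBisector x δ θ) (hδ : 0 < δ) {K : ℝ}
    (hK0 : 0 < K) (hK : ∀ u v, |DX (x u) (x v)| ≤ K * |u - v|) {σ η : ℝ} (h0 : 0 ≤ η)
    {r : ℝ} (hr : r ∈ Icc (σ - η) (σ + η)) :
    |DX (x r) (x' (σ + η) - x' (σ - η))| ≤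
      2 * K * η * ∫ u in (σ - η)..(σ + η), DX (x' u) (deriv x' u) := by
  have hlac := h.left.lac.clm (DX (x r))
  have hae : ∀ᵐ u, HasDerivAt (fun u => DX (x r) (x' u))
      (-DX (x' u) (deriv x' u) * DX (x r) (x u)) u ∧ 0 ≤ DX (x' u) (deriv x' u) := by
    filter_upwards [h.left.lac.ae_differentiableAt] with u hu
    have h1 := (DX (x r)).hasFDerivAt.comp_hasDerivAt u hu.hasDerivAt
    refine ⟨h1.congr_deriv ?_, ?_⟩
    · nth_rewrite 1 [(h.hill hu.hasDerivAt).2]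
      rw [map_smul, smul_eq_mul]
    · simpa [h.area_eq_one] using h.left.curvature_nonneg hθ hδ hu.hasDerivAt
  have hftc := hlac.integral_eq_sub (hae.mono fun u hu => hu.1) (σ - η) (σ + η)
  rw [map_sub, ← hftc, ← Real.norm_eq_abs, ← intervalIntegral.integral_const_mul]
  refine intervalIntegral.norm_integral_le_of_norm_le (by linarith) ?_
    ((h.left.locallyIntegrable_curvature.intervalIntegrable_real _ _).const_mul _)
  filter_upwards [hae] with u hu hmem
  rw [norm_mul, norm_neg, Real.norm_eq_abs, Real.norm_eq_abs, abs_of_nonneg hu.2, mul_comm]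
  refine mul_le_mul_of_nonneg_right ((hK r u).trans ?_) hu.2
  have : |r - u| ≤ 2 * η := by
    rw [abs_le]; constructor <;> linarith [hr.1, hr.2, hmem.1, hmem.2]
  nlinarith

/-- The square root of the curvature is locally integrable. -/
theorem locallyIntegrable_sqrt_curvature :
    LocallyIntegrable fun u => √(DX (x' u) (deriv x' u)) := by
  have hE := h.left.locallyIntegrable_curvature
  refine (hE.add (locallyIntegrable_const (1 : ℝ))).mono
    (hE.aestronglyMeasurable.aemeasurable.sqrt.aestronglyMeasurable)
    (Eventually.of_forall fun u => ?_)
  simp only [Pi.add_apply, Real.norm_eq_abs]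
  rw [abs_of_nonneg (Real.sqrt_nonneg _)]
  rcases le_or_gt 0 (DX (x' u) (deriv x' u)) with hE0 | hE0
  · rw [abs_of_nonneg (by positivity), Real.sqrt_le_left (by positivity)]
    nlinarith
  · rw [Real.sqrt_eq_zero_of_nonpos hE0.le]
    positivity

variable [FiniteDimensional ℝ Y]

/-- Integrated comparison of the bisectors of the two curves along a band `t - s = 2η` parallel to
the diagonal; the error is `o(η²)`. -/
theorem integral_bisector_le {δ c : ℝ} (hδ : 0 < δ) (hc : 0 < c)
    (hcx : ∀ u v, |u - v| ≤ δ → c ≤ DX (x u) (x' v))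
    (hcy : ∀ u v, |u - v| ≤ δ → c ≤ DY (y u) (y' v))
    {θ χ : ℝ → ℝ → ℝ} (hθ : IsBisector x δ θ) (hχ : IsBisector y δ χ) {a b : ℝ} (hab : a ≤ b)
    {ε : ℝ} (hε : 0 < ε) :
    ∃ ρ > 0, ∀ η, 0 < η → η < ρ →
      (1 - ε * η ^ 2) * ∫ u in θ (a - η) (a + η)..θ (b - η) (b + η), √(DX (x' u) (deriv x' u)) ≤
        ∫ u in χ (a - η) (a + η)..χ (b - η) (b + η), √(DX (x' u) (deriv x' u)) := by
  obtain ⟨K, hK0, hK⟩ := h.left.exists_lipschitz_area h.periodic_left h.pos.ne'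
  set S : ℝ → ℝ := fun u => √(DX (x' u) (deriv x' u)) with hS
  obtain ⟨ρ, hρ, H⟩ := h.left.locallyIntegrable_curvature.exists_forall_integral_le a b
    (ε := √ε * c / K) (by positivity)
  -- `speed_le` is applied with relative imbalance `√ε * η`, which must not exceed one
  refine ⟨min ρ (min (δ / 2) (1 / √ε)), by positivity, fun η h0 hη => ?_⟩
  have hη1 : η < ρ := hη.trans_le (min_le_left _ _)
  have hη2 : 2 * η < δ := by
    have := hη.trans_le ((min_le_right _ _).trans (min_le_left _ _))
    linarith
  have hη3 : √ε * η ≤ 1 := by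
    have := hη.trans_le ((min_le_right _ _).trans (min_le_right _ _))
    rw [lt_div_iff₀ (by positivity)] at this
    linarith
  have hmemx : ∀ σ, θ (σ - η) (σ + η) ∈ Icc (σ - η) (σ + η) := fun σ =>
    hθ.mem_Icc _ _ (by linarith) (by linarith)
  have hmemy : ∀ σ, χ (σ - η) (σ + η) ∈ Icc (σ - η) (σ + η) := fun σ =>
    hχ.mem_Icc _ _ (by linarith) (by linarith)
  have hx1 : ∀ σ, c ≤ DX (x (θ (σ - η) (σ + η))) (x' (σ - η)) := fun σ =>
    hcx _ _ (by rw [abs_le]; constructor <;> linarith [(hmemx σ).1, (hmemx σ).2])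
  have hx2 : ∀ σ, c ≤ DX (x (θ (σ - η) (σ + η))) (x' (σ + η)) := fun σ =>
    hcx _ _ (by rw [abs_le]; constructor <;> linarith [(hmemx σ).1, (hmemx σ).2])
  have hy1 : ∀ σ, c ≤ DY (y (χ (σ - η) (σ + η))) (y' (σ - η)) := fun σ =>
    hcy _ _ (by rw [abs_le]; constructor <;> linarith [(hmemy σ).1, (hmemy σ).2])
  have hy2 : ∀ σ, c ≤ DY (y (χ (σ - η) (σ + η))) (y' (σ + η)) := fun σ =>
    hcy _ _ (by rw [abs_le]; constructor <;> linarith [(hmemy σ).1, (hmemy σ).2])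
  have hPx : ∀ σ, 0 < ‖x (σ - η) + x (σ + η)‖ := fun σ =>
    hθ.norm_pos _ _ (by linarith) (by linarith)
  have hdx := fun σ => h.left.hasDerivAt_bisector_symm hθ (σ := σ) h0 hη2
  have hdy := fun σ => h.right.hasDerivAt_bisector_symm hχ (σ := σ) h0 hη2
  have hpx : ∀ σ, 0 < DX (x (θ (σ - η) (σ + η))) (x' (σ - η) + x' (σ + η)) /
      (‖x (σ - η) + x (σ + η)‖ * DX (x (θ (σ - η) (σ + η))) (x' (θ (σ - η) (σ + η)))) := by
    intro σ
    refine div_pos ?_ (mul_pos (hPx σ) (h.left.pos _))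
    rw [map_add]; linarith [hx1 σ, hx2 σ]
  have hpy : ∀ σ, 0 < DY (y (χ (σ - η) (σ + η))) (y' (σ - η) + y' (σ + η)) /
      (‖y (σ - η) + y (σ + η)‖ * DY (y (χ (σ - η) (σ + η))) (y' (χ (σ - η) (σ + η)))) := by
    intro σ
    refine div_pos ?_ (mul_pos (by rw [← h.norm_add]; exact hPx σ) (h.right.pos _))
    rw [map_add]; linarith [hy1 σ, hy2 σ]
  have hSint := h.locallyIntegrable_sqrt_curvature
  obtain ⟨ix, ex⟩ := integral_comp_of_hasDerivAt_pos hdx hpx hSint hab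
  obtain ⟨iy, ey⟩ := integral_comp_of_hasDerivAt_pos hdy hpy hSint hab
  rw [← ex, ← ey, ← intervalIntegral.integral_const_mul]
  refine intervalIntegral.integral_mono_ae_restrict hab (ix.const_mul _) iy ?_
  have hgood := h.left.lac.ae_differentiableAt.and h.right.lac.ae_differentiableAt
  rw [EventuallyLE, ae_restrict_iff' measurableSet_Icc]
  filter_upwards [ae_comp_of_hasDerivAt_pos hdx hpx hgood, ae_comp_of_hasDerivAt_pos hdy hpy hgood]
    with σ gx gy hσ
  have hbound := h.abs_area_sub_le hθ hδ hK0 hK h0.le (hmemx σ)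
  have hle : 2 * K * η * ∫ u in (σ - η)..(σ + η), DX (x' u) (deriv x' u) ≤
      √ε * η * DX (x (θ (σ - η) (σ + η))) (x' (σ - η) + x' (σ + η)) := by
    have e1 := H σ hσ η h0.le hη1
    have e2 : 2 * c ≤ DX (x (θ (σ - η) (σ + η))) (x' (σ - η) + x' (σ + η)) := by
      rw [map_add]; linarith [hx1 σ, hx2 σ]
    calc _ ≤ 2 * K * η * (√ε * c / K) := by gcongr
      _ = √ε * η * (2 * c) := by field_simp
      _ ≤ _ := by gcongr
  have hsp := h.speed_le hθ hχ hδ (by linarith : σ - η < σ + η) (by linarith)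
    gx.1.hasDerivAt gy.2.hasDerivAt gy.1.hasDerivAt (hc.trans_le (hx1 σ)) (hc.trans_le (hx2 σ))
    (hc.trans_le (hy1 σ)) (hc.trans_le (hy2 σ)) (ε := √ε * η) (by positivity) hη3
    (hbound.trans hle)
  rw [mul_pow, Real.sq_sqrt hε.le] at hsp
  have hP := hPx σ
  have e3 := mul_le_mul_of_nonneg_left hsp (inv_nonneg.2 hP.le)
  rw [← h.norm_add, h.area_eq_one, mul_one]
  calc _ = _ := ?_
    _ ≤ _ := e3
    _ = _ := ?_
  · rw [div_eq_mul_inv]; ring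
  · have hw := (h.right.pos (χ (σ - η) (σ + η))).ne'
    field_simp

end HillPair

end Rigidity

/-! ### Rigidity of pairs of curves with the same metric -/

section Linear

variable {X : Type*} [NormedAddCommGroup X] [NormedSpace ℝ X]
variable {Y : Type*} [NormedAddCommGroup Y] [NormedSpace ℝ Y]

/-- Two curves with the same mutual distances have the same speed. -/
theorem HasDerivAt.norm_eq_of_norm_sub_eq {f : ℝ → X} {g : ℝ → Y} {f' : X} {g' : Y} {s : ℝ}
    (hf : HasDerivAt f f' s) (hg : HasDerivAt g g' s)
    (h : ∀ t, ‖f t - f s‖ = ‖g t - g s‖) : ‖f'‖ = ‖g'‖ := by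
  rw [hasDerivAt_iff_tendsto_slope] at hf hg
  refine tendsto_nhds_unique (hf.norm.congr fun t => ?_) hg.norm
  rw [slope_def_module, slope_def_module, norm_smul, norm_smul, h]

theorem SphereCurve.hasDerivWithinAt_comp_bisector {D : X →L[ℝ] X →L[ℝ] ℝ} {z z' : ℝ → X}
    (hz : SphereCurve D z z') {δ : ℝ} {θ : ℝ → ℝ → ℝ} (hθ : IsBisector z δ θ) (hδ : 0 < δ)
    {B : ℝ → ℝ} {S m : ℝ} {z'' : X} (hB : HasDerivAt B S m) (hm : HasDerivAt z' z'' m) :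
    HasDerivWithinAt (fun κ => B (θ (m - √κ) (m + √κ)))
      (S * (D (z m) z'' / (2 * D (z m) (z' m)))) (Ici 0) 0 := by
  have h1 := (hz.hasDerivWithinAt_near_diagonal hθ hδ hm).1
  have h2 : θ (m - √0) (m + √0) = m := by simpa using hθ.self_eq hδ m
  rw [← h2] at hB
  have := hB.comp_hasDerivWithinAt (0 : ℝ) h1
  exact this

namespace HillPair

variable {DX : X →L[ℝ] X →L[ℝ] ℝ} {DY : Y →L[ℝ] Y →L[ℝ] ℝ} {x x' : ℝ → X} {y y' : ℝ → Y} {T : ℝ}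
  (h : HillPair DX DY x x' y y' T)
include h

theorem speed_eq (s : ℝ) : ‖x' s‖ = ‖y' s‖ :=
  (h.left.hasDerivAt s).norm_eq_of_norm_sub_eq (h.right.hasDerivAt s) fun t => h.norm_sub t s

/-- Where the curvature vanishes, so does the tangential acceleration: there it would be the
logarithmic derivative of the speed, which is the same for both curves. -/
theorem tangential_eq_zero_of_curvature {m : ℝ} {x'' : X} {y'' : Y}
    (hx : HasDerivAt x' x'' m) (hy : HasDerivAt y' y'' m) (h0 : DX (x' m) x'' = 0) :
    DY (y m) y'' = 0 := by
  obtain ⟨δ, hδ, c, hc, hcx, hcy⟩ := h.exists_forall_le_area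
  obtain ⟨θ, hθ⟩ := h.left.exists_isBisector hc hcx
  obtain ⟨χ, hχ⟩ := h.right.exists_isBisector hc hcy
  have hw := (h.right.pos m).ne'
  have e1 := h.curvature_eq hθ hχ hδ hx hy
  rw [h0, eq_comm, div_eq_zero_iff, or_iff_left hw] at e1
  have e2 : y'' = (DY (y m) y'' / DY (y m) (y' m)) • y' m := by
    have := h.right.area.smul_eq (y m) (y' m) y''
    rw [h.right.area.swap y'', e1, neg_zero, zero_smul, zero_add] at this
    rw [div_eq_inv_mul, mul_smul, ← this, smul_smul, inv_mul_cancel₀ hw, one_smul]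
  have e3 : x'' = (0 : ℝ) • x' m := by
    rw [(h.hill hx).2, h0]; simp
  rw [e2] at hy
  rw [e3] at hx
  have n1 := hx.norm_of_smul_self
  have n2 := hy.norm_of_smul_self
  simp only [← h.speed_eq] at n2
  have n3 := n2.unique n1
  rw [zero_mul, mul_eq_zero, div_eq_zero_iff, or_iff_left hw] at n3
  refine n3.resolve_right fun h1 => ?_
  have := h.left.pos m
  rw [norm_eq_zero.1 h1, map_zero] at this
  exact this.false

variable [FiniteDimensional ℝ X] [FiniteDimensional ℝ Y]

/-- The tangential acceleration of `y`, weighted by the square root `S` of the curvature, is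
nondecreasing. With `B` a primitive of `S`, the comparison of the bisectors says that the increment
of `B` between the bisecting parameters near `a` and near `b` is at least as large for `y` as for
`x`, up to `o(κ)`, where `κ` is the squared half-distance; there is equality at `κ = 0`, and the claim is
that the derivative of the difference in `κ` is nonnegative. -/
theorem tangential_le {a b : ℝ} (hab : a ≤ b)
    (hax : DifferentiableAt ℝ x' a) (hay : DifferentiableAt ℝ y' a)
    (hbx : DifferentiableAt ℝ x' b) (hby : DifferentiableAt ℝ y' b)
    (hBa : HasDerivAt (fun s => ∫ u in (0 : ℝ)..s, √(DX (x' u) (deriv x' u)))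
      (√(DX (x' a) (deriv x' a))) a)
    (hBb : HasDerivAt (fun s => ∫ u in (0 : ℝ)..s, √(DX (x' u) (deriv x' u)))
      (√(DX (x' b) (deriv x' b))) b) :
    √(DX (x' a) (deriv x' a)) * (DY (y a) (deriv y' a) / DY (y a) (y' a)) ≤
      √(DX (x' b) (deriv x' b)) * (DY (y b) (deriv y' b) / DY (y b) (y' b)) := by
  obtain ⟨δ, hδ, c, hc, hcx, hcy⟩ := h.exists_forall_le_area
  obtain ⟨θ, hθ⟩ := h.left.exists_isBisector hc hcx
  obtain ⟨χ, hχ⟩ := h.right.exists_isBisector hc hcy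
  have hint := h.locallyIntegrable_sqrt_curvature.intervalIntegrable_real
  set S : ℝ → ℝ := fun u => √(DX (x' u) (deriv x' u)) with hS
  set B : ℝ → ℝ := fun s => ∫ u in (0 : ℝ)..s, S u with hB
  have dya := h.right.hasDerivWithinAt_comp_bisector hχ hδ hBa hay.hasDerivAt
  have dyb := h.right.hasDerivWithinAt_comp_bisector hχ hδ hBb hby.hasDerivAt
  have dxa := h.left.hasDerivWithinAt_comp_bisector hθ hδ hBa hax.hasDerivAt
  have dxb := h.left.hasDerivWithinAt_comp_bisector hθ hδ hBb hbx.hasDerivAt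
  rw [(h.hill hax.hasDerivAt).1, zero_div, mul_zero] at dxa
  rw [(h.hill hbx.hasDerivAt).1, zero_div, mul_zero] at dxb
  have dΦ := (dyb.fun_sub dya).fun_sub (dxb.fun_sub dxa)
  rw [sub_zero, sub_zero] at dΦ
  set M := B b - B a + 1 with hM
  have hBab : 0 ≤ B b - B a := by
    rw [hB, intervalIntegral.integral_interval_sub_left (hint _ _) (hint _ _)]
    exact intervalIntegral.integral_nonneg hab fun u _ => Real.sqrt_nonneg _
  have hself : ∀ m, θ (m - √0) (m + √0) = m ∧ χ (m - √0) (m + √0) = m := fun m =>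
    ⟨by simpa using hθ.self_eq hδ m, by simpa using hχ.self_eq hδ m⟩
  have hev : ∀ᶠ κ in 𝓝[>] (0 : ℝ),
      B (θ (b - √κ) (b + √κ)) - B (θ (a - √κ) (a + √κ)) < M := by
    have := (dxb.fun_sub dxa).continuousWithinAt.tendsto.mono_left
      (nhdsWithin_mono _ Ioi_subset_Ici_self)
    refine this.eventually (gt_mem_nhds ?_)
    rw [(hself b).1, (hself a).1]
    linarith
  suffices hmain : ∀ ε > 0, 0 ≤ (S b * (DY (y b) (deriv y' b) / (2 * DY (y b) (y' b))) -
      S a * (DY (y a) (deriv y' a) / (2 * DY (y a) (y' a)))) + ε by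
    have h1 := le_of_forall_pos_le_add hmain
    have h2 : S b * (DY (y b) (deriv y' b) / (2 * DY (y b) (y' b))) -
      S a * (DY (y a) (deriv y' a) / (2 * DY (y a) (y' a))) =
      (S b * (DY (y b) (deriv y' b) / DY (y b) (y' b)) -
        S a * (DY (y a) (deriv y' a) / DY (y a) (y' a))) / 2 := by
      have := (h.right.pos a).ne'
      have := (h.right.pos b).ne'
      field_simp
    rw [h2] at h1
    linarith
  intro ε hε
  have hM0 : 0 < M := by linarith
  obtain ⟨ρ, hρ, H⟩ := h.integral_bisector_le hδ hc hcx hcy hθ hχ hab (ε := ε / M) (by positivity)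
  have dΨ := dΦ.fun_add (((hasDerivAt_id (0 : ℝ)).const_mul ε).hasDerivWithinAt (s := Ici 0))
  rw [mul_one] at dΨ
  refine dΨ.nonneg_of_eventually_le ?_
  have hκ : ∀ᶠ κ in 𝓝[>] (0 : ℝ), κ ∈ Ioo 0 (ρ ^ 2) := Ioo_mem_nhdsGT (by positivity)
  filter_upwards [hev, hκ] with κ h1 h2
  have h3 : √κ < ρ := by
    rw [Real.sqrt_lt' hρ]; exact h2.2
  have h4 := H (√κ) (Real.sqrt_pos.2 h2.1) h3
  have hsub : ∀ p q, ∫ u in p..q, √(DX (x' u) (deriv x' u)) = B q - B p := fun p q =>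
    (intervalIntegral.integral_interval_sub_left (hint 0 _) (hint 0 _)).symm
  rw [hsub, hsub, Real.sq_sqrt h2.1.le] at h4
  simp only [(hself _).1, (hself _).2, id, mul_zero]
  have h5 : ε / M * κ * (B (θ (b - √κ) (b + √κ)) - B (θ (a - √κ) (a + √κ))) ≤ ε / M * κ * M := by
    have := h2.1
    gcongr
  have h6 : ε / M * κ * M = ε * κ := by field_simp
  linarith

/-- The tangential acceleration of `y` vanishes almost everywhere. -/
theorem tangential_eq_zero : ∀ᵐ m, DY (y m) (deriv y' m) = 0 := by
  set S : ℝ → ℝ := fun u => √(DX (x' u) (deriv x' u)) with hS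
  set F : ℝ → ℝ := fun m => S m * (DY (y m) (deriv y' m) / DY (y m) (y' m)) with hF
  have px' := h.periodic_left.deriv_of_hasDerivAt h.left.hasDerivAt
  have py' := h.periodic_right.deriv_of_hasDerivAt h.right.hasDerivAt
  have px'' : Function.Periodic (deriv x') T := fun s => by
    rw [← deriv_comp_add_const, funext px']
  have py'' : Function.Periodic (deriv y') T := fun s => by
    rw [← deriv_comp_add_const, funext py']
  have pF : Function.Periodic F T := fun s => by
    simp only [hF, hS, px' s, px'' s, py' s, py'' s, h.periodic_right s]
  have hgood : ∀ᵐ m, DifferentiableAt ℝ x' m ∧ DifferentiableAt ℝ y' m ∧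
      HasDerivAt (fun s => ∫ u in (0 : ℝ)..s, S u) (S m) m := by
    filter_upwards [h.left.lac.ae_differentiableAt, h.right.lac.ae_differentiableAt,
      LocallyIntegrable.ae_hasDerivAt_integral h.locallyIntegrable_sqrt_curvature] with m h1 h2 h3
    exact ⟨h1, h2, h3 0⟩
  -- almost every point is good together with all its translates by periods
  have hgood' := ae_all_iff.2 fun k : ℤ => ae_comp_of_hasDerivAt_pos (φ := fun s => s + k * T)
    (φ' := fun _ => 1) (fun s => (hasDerivAt_id s).add_const _) (fun _ => one_pos) hgood
  have hle : ∀ m₁ m₂, (∀ k : ℤ, DifferentiableAt ℝ x' (m₁ + k * T) ∧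
      DifferentiableAt ℝ y' (m₁ + k * T) ∧
      HasDerivAt (fun s => ∫ u in (0 : ℝ)..s, S u) (S (m₁ + k * T)) (m₁ + k * T)) →
      (∀ k : ℤ, DifferentiableAt ℝ x' (m₂ + k * T) ∧ DifferentiableAt ℝ y' (m₂ + k * T) ∧
      HasDerivAt (fun s => ∫ u in (0 : ℝ)..s, S u) (S (m₂ + k * T)) (m₂ + k * T)) →
      F m₁ ≤ F m₂ := by
    intro m₁ m₂ g1 g2
    have hk : m₁ ≤ m₂ + (⌈(m₁ - m₂) / T⌉ : ℤ) * T := by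
      have := Int.le_ceil ((m₁ - m₂) / T)
      rw [div_le_iff₀ h.pos] at this
      linarith
    have a1 := g1 0
    simp only [Int.cast_zero, zero_mul, add_zero] at a1
    have a2 := g2 ⌈(m₁ - m₂) / T⌉
    have := h.tangential_le hk a1.1 a1.2.1 a2.1 a2.2.1 a1.2.2 a2.2.2
    have e : F (m₂ + (⌈(m₁ - m₂) / T⌉ : ℤ) * T) = F m₂ := pF.int_mul _ _
    rw [← e]
    exact this
  obtain ⟨m₀, hm₀⟩ := hgood'.exists
  have hFc : ∀ᵐ m, F m = F m₀ :=
    hgood'.mono fun m hm => le_antisymm (hle _ _ hm hm₀) (hle _ _ hm₀ hm)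
  -- otherwise `F m₀ * DY (y, y')` would have an almost everywhere positive derivative
  have hF0 : F m₀ = 0 := by
    by_contra hne
    have hder : ∀ᵐ m, HasDerivAt (fun s => F m₀ * DY (y s) (y' s)) (F m₀ * DY (y m) (deriv y' m)) m
        ∧ 0 < F m₀ * DY (y m) (deriv y' m) := by
      filter_upwards [hFc, h.right.lac.ae_differentiableAt] with m h1 h2
      constructor
      · have := ((h.right.hasDerivAt m).area (D := DY) h2.hasDerivAt).const_mul (F m₀)
        rwa [h.right.area.self_eq_zero, zero_add] at this
      · have hw := h.right.pos m
        have hS0 : 0 ≤ S m := Real.sqrt_nonneg _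
        rw [← h1]
        have e : F m * DY (y m) (deriv y' m) =
            S m * (DY (y m) (deriv y' m)) ^ 2 / DY (y m) (y' m) := by
          simp only [hF]; ring
        refine lt_of_le_of_ne (by rw [e]; positivity) fun h0 => hne ?_
        rw [← h1]
        rcases mul_eq_zero.1 h0.symm with h3 | h3
        · exact h3
        · simp [hF, h3]
    have hlac : LocallyAbsolutelyContinuous fun s => F m₀ * DY (y s) (y' s) :=
      h.right.lac_area.clm (ContinuousLinearMap.lsmul ℝ ℝ (F m₀))
    have hi := hlac.integral_eq_sub (hder.mono fun m hm => hm.1) 0 T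
    have e0 := h.periodic_right 0
    have e1 := py' 0
    rw [zero_add] at e0 e1
    rw [e0, e1, sub_self] at hi
    have hint : IntervalIntegrable (fun m => F m₀ * DY (y m) (deriv y' m)) volume 0 T := by
      refine (hlac.locallyIntegrable_deriv_real.congr ?_).intervalIntegrable_real 0 T
      exact hder.mono fun m hm => hm.1.deriv
    have h2 := (intervalIntegral.integral_eq_zero_iff_of_le_of_nonneg_ae h.pos.le
      (ae_restrict_of_ae (hder.mono fun m hm => hm.2.le)) hint).1 hi
    have h3 : ∀ᵐ m ∂(volume.restrict (Ioc 0 T)), False := by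
      filter_upwards [h2, ae_restrict_of_ae hder] with m h4 h5
      exact h5.2.ne' h4
    have h4 := (ae_iff.1 h3)
    simp at h4
    exact absurd h.pos (not_lt.2 h4)
  filter_upwards [hFc, h.left.lac.ae_differentiableAt, h.right.lac.ae_differentiableAt]
    with m h1 h2 h3
  rw [hF0] at h1
  have hw := (h.right.pos m).ne'
  rcases mul_eq_zero.1 h1 with h4 | h4
  · obtain ⟨δ, hδ, c, hc, hcx, hcy⟩ := h.exists_forall_le_area
    obtain ⟨θ, hθ⟩ := h.left.exists_isBisector hc hcx
    have hE : 0 ≤ DX (x' m) (deriv x' m) := by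
      simpa [h.area_eq_one] using h.left.curvature_nonneg hθ hδ h2.hasDerivAt
    exact h.tangential_eq_zero_of_curvature h2.hasDerivAt h3.hasDerivAt
      ((Real.sqrt_eq_zero hE).1 h4)
  · exact (div_eq_zero_iff.1 h4).resolve_right hw

/-- The two curves correspond under a linear map. Both solve the same Hill equation, so that
`DX(v, x') y - DX(v, x) y'` is constant for every `v`. -/
theorem exists_linearMap : ∃ F : X →ₗ[ℝ] Y, ∀ s, F (x s) = y s := by
  obtain ⟨δ, hδ, c, hc, hcx, hcy⟩ := h.exists_forall_le_area
  obtain ⟨θ, hθ⟩ := h.left.exists_isBisector hc hcx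
  obtain ⟨χ, hχ⟩ := h.right.exists_isBisector hc hcy
  -- the derivative vanishes where both second derivatives exist
  have hconst : ∀ v s, DX v (x' s) • y s - DX v (x s) • y' s =
      DX v (x' 0) • y 0 - DX v (x 0) • y' 0 := by
    intro v s
    have hlac : LocallyAbsolutelyContinuous fun s => DX v (x' s) • y s - DX v (x s) • y' s :=
      ((h.left.lac.clm (DX v)).smul h.right.lac_self).sub
        ((h.left.lac_self.clm (DX v)).smul h.right.lac)
    refine hlac.const_of_ae_hasDerivAt_zero ?_ s 0
    filter_upwards [h.left.lac.ae_differentiableAt, h.right.lac.ae_differentiableAt,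
      h.tangential_eq_zero] with u h1 h2 h3
    have hw := (h.right.pos u).ne'
    have e1 := h.curvature_eq hθ hχ hδ h1.hasDerivAt h2.hasDerivAt
    have e2 := h.right.area.smul_eq (y u) (y' u) (deriv y' u)
    rw [h3, zero_smul, add_zero, h.right.area.swap (deriv y' u)] at e2
    have e3 : deriv y' u = -DX (x' u) (deriv x' u) • y u := by
      rw [e1, ← neg_div, div_eq_inv_mul, mul_smul, ← e2, smul_smul, inv_mul_cancel₀ hw, one_smul]
    have d1 := (((DX v).hasFDerivAt.comp_hasDerivAt u h1.hasDerivAt).smul (h.right.hasDerivAt u))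
    have d2 := (((DX v).hasFDerivAt.comp_hasDerivAt u (h.left.hasDerivAt u)).smul h2.hasDerivAt)
    refine (d1.fun_sub d2).congr_deriv ?_
    rw [e3]
    nth_rewrite 1 [(h.hill h1.hasDerivAt).2]
    simp only [Function.comp, map_smul, smul_eq_mul]
    module
  refine ⟨{ toFun := fun v => DX v (x' 0) • y 0 - DX v (x 0) • y' 0, map_add' := fun u v => ?_,
            map_smul' := fun r v => ?_ }, fun s => ?_⟩
  · simp only [map_add, add_apply]; module
  · simp only [map_smul, smul_apply, RingHom.id_apply, smul_eq_mul]; module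
  · change DX (x s) (x' 0) • y 0 - DX (x s) (x 0) • y' 0 = y s
    rw [← hconst (x s) s, h.area_eq_one, h.left.area.self_eq_zero, one_smul, zero_smul, sub_zero]

end HillPair

end Linear

/-! ### Unit-speed curves and isometries of spheres -/

section UnitSpeed

variable {X : Type*} [NormedAddCommGroup X] [NormedSpace ℝ X]
variable {Y : Type*} [NormedAddCommGroup Y] [NormedSpace ℝ Y]

theorem Continuous.forall_pos_or_forall_neg {f : ℝ → ℝ} (hf : Continuous f) (h : ∀ s, f s ≠ 0) :
    (∀ s, 0 < f s) ∨ ∀ s, f s < 0 := by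
  by_contra! hcon
  obtain ⟨⟨a, ha⟩, ⟨b, hb⟩⟩ := hcon
  obtain ⟨s, hs⟩ := mem_range_of_exists_le_of_exists_ge hf ⟨a, ha⟩ ⟨b, hb⟩
  exact h s hs

/-- A `C¹` curve on the unit sphere with nonvanishing velocity is a `SphereCurve` for a suitably
oriented area form. -/
theorem exists_sphereCurve (h2 : Module.finrank ℝ X = 2) {z z' : ℝ → X} (hn : ∀ s, ‖z s‖ = 1)
    (hd : ∀ s, HasDerivAt z (z' s) s) (hlac : LocallyAbsolutelyContinuous z')
    (h0 : ∀ s, z' s ≠ 0) : ∃ D : X →L[ℝ] X →L[ℝ] ℝ, SphereCurve D z z' := by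
  obtain ⟨D, hD, hnd⟩ := exists_isAreaForm h2
  have hzc : Continuous z := continuous_iff_continuousAt.2 fun s => (hd s).continuousAt
  have hzc' := hlac.continuous
  have hne : ∀ s, D (z s) (z' s) ≠ 0 := by
    intro s hs
    have hz0 : z s ≠ 0 := fun h => by
      have := hn s
      rw [h, norm_zero] at this
      norm_num at this
    -- a velocity parallel to the position would change the norm
    obtain ⟨c, hc⟩ := hnd _ _ hs hz0
    have h3 := hd s
    rw [hc] at h3
    have h4 := h3.norm_of_smul_self
    simp only [hn] at h4
    have h5 := h4.unique (hasDerivAt_const s 1)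
    rw [mul_one] at h5
    exact h0 s (by rw [hc, h5, zero_smul])
  rcases (by fun_prop : Continuous fun s => D (z s) (z' s)).forall_pos_or_forall_neg hne with h | h
  · exact ⟨D, hD, hn, hd, hlac, h⟩
  · exact ⟨-D, hD.neg, hn, hd, hlac, fun s => by simpa using h s⟩

namespace SphereCurve

variable {DX : X →L[ℝ] X →L[ℝ] ℝ} {r r' : ℝ → X} (hr : SphereCurve DX r r')
  {D : Y →L[ℝ] Y →L[ℝ] ℝ} {z z' : ℝ → Y} (hz : SphereCurve D z z')

include hz in
/-- Unit vectors near a point `z u₀` of the curve lie on the curve, with a parameter near `u₀`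
depending on the vector in a Lipschitz way. -/
theorem exists_local_parameter (u₀ : ℝ) :
    ∃ ρ > 0, ∃ K, ∃ G : Y → ℝ, (∀ᶠ u in 𝓝 u₀, G (z u) = u) ∧
      (∀ v, ‖v‖ = 1 → ‖v - z u₀‖ < ρ → z (G v) = v) ∧
      ∀ v₁ v₂, ‖v₁‖ = 1 → ‖v₂‖ = 1 → ‖v₁ - z u₀‖ < ρ → ‖v₂ - z u₀‖ < ρ →
        |G v₁ - G v₂| ≤ K * ‖v₁ - v₂‖ := by
  have hw := hz.pos u₀
  set κ := D (z u₀) (z' u₀) / 2 with hκ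
  have hκ0 : 0 < κ := by positivity
  have hcont : Continuous fun p : Y × ℝ => D p.1 (z' p.2) := by
    have := hz.continuous_deriv
    fun_prop
  have hev : ∀ᶠ p : Y × ℝ in 𝓝 (z u₀, u₀), κ < D p.1 (z' p.2) :=
    hcont.continuousAt.eventually (lt_mem_nhds (by simp only [hκ]; linarith))
  obtain ⟨δ, hδ, hball⟩ := Metric.eventually_nhds_iff.1 hev
  have hlow : ∀ v u, ‖v - z u₀‖ < δ → u ∈ Icc (u₀ - δ / 2) (u₀ + δ / 2) → κ < D v (z' u) := by
    intro v u hv hu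
    refine hball (y := (v, u)) ?_
    rw [Prod.dist_eq, max_lt_iff, dist_eq_norm, Real.dist_eq, abs_lt]
    exact ⟨hv, by linarith [hu.1], by linarith [hu.2]⟩
  have hder : ∀ u, HasDerivAt (fun u => D (z u₀) (z u)) (D (z u₀) (z' u)) u := fun u =>
    (D (z u₀)).hasFDerivAt.comp_hasDerivAt u (hz.hasDerivAt u)
  have hmono : StrictMonoOn (fun u => D (z u₀) (z u)) (Icc (u₀ - δ / 2) (u₀ + δ / 2)) := by
    refine strictMonoOn_of_deriv_pos (convex_Icc _ _)
      (continuous_iff_continuousAt.2 fun u => (hder u).continuousAt).continuousOn fun u hu => ?_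
    rw [interior_Icc] at hu
    rw [(hder u).deriv]
    exact hκ0.trans (hlow _ _ (by simpa using hδ) (Ioo_subset_Icc_self hu))
  have hm0 : u₀ ∈ Icc (u₀ - δ / 2) (u₀ + δ / 2) := ⟨by linarith, by linarith⟩
  have hneg : D (z u₀) (z (u₀ - δ / 2)) < 0 := by
    have := hmono ⟨le_rfl, by linarith⟩ hm0 (by linarith : u₀ - δ / 2 < u₀)
    simpa [hz.area.self_eq_zero] using this
  have hpos : 0 < D (z u₀) (z (u₀ + δ / 2)) := by
    have := hmono hm0 ⟨by linarith, le_rfl⟩ (by linarith : u₀ < u₀ + δ / 2)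
    simpa [hz.area.self_eq_zero] using this
  have hsgn : ∀ᶠ v in 𝓝 (z u₀), D v (z (u₀ - δ / 2)) < 0 ∧ 0 < D v (z (u₀ + δ / 2)) := by
    have c1 : Continuous fun v => D v (z (u₀ - δ / 2)) := by fun_prop
    have c2 : Continuous fun v => D v (z (u₀ + δ / 2)) := by fun_prop
    exact (c1.continuousAt.eventually (gt_mem_nhds hneg)).and
      (c2.continuousAt.eventually (lt_mem_nhds hpos))
  obtain ⟨ρ, hρ, hsgn'⟩ := Metric.eventually_nhds_iff.1 hsgn
  have hex : ∀ v : Y, ∃ u, ‖v‖ = 1 → ‖v - z u₀‖ < min δ ρ →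
      u ∈ Icc (u₀ - δ / 2) (u₀ + δ / 2) ∧ z u = v := by
    intro v
    by_cases hv : ‖v‖ = 1 ∧ ‖v - z u₀‖ < min δ ρ
    · have hs := hsgn' (y := v) (by rw [dist_eq_norm]; exact hv.2.trans_le (min_le_right _ _))
      obtain ⟨u, hu, -, he⟩ := hz.exists_eq_norm_smul (by linarith) hs.1.le hs.2.le
        (fun u hu => hκ0.trans (hlow v u (hv.2.trans_le (min_le_left _ _)) hu))
      rw [hv.1, one_smul] at he
      exact ⟨u, fun _ _ => ⟨hu, he.symm⟩⟩
    · exact ⟨0, fun h1 h2 => absurd ⟨h1, h2⟩ hv⟩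
  choose G hG using hex
  have hρ0 : 0 < min δ ρ := lt_min hδ hρ
  have key : ∀ v, ∀ u₁ ∈ Icc (u₀ - δ / 2) (u₀ + δ / 2), ∀ u₂ ∈ Icc (u₀ - δ / 2) (u₀ + δ / 2),
      ‖v - z u₀‖ < min δ ρ → z u₁ = v → κ * |u₁ - u₂| ≤ ‖D‖ * ‖z u₁ - z u₂‖ := by
    intro v u₁ h1 u₂ h2 hv hv1
    refine (hz.mul_abs_sub_le (v := v) fun u hu => ?_).trans ?_
    · exact (hlow v u (hv.trans_le (min_le_left _ _)) ⟨(le_min h1.1 h2.1).trans hu.1,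
        hu.2.trans (max_le h1.2 h2.2)⟩).le
    · rw [← map_sub, ← Real.norm_eq_abs]
      refine (D.le_opNorm₂ _ _).trans (le_of_eq ?_)
      rw [← hv1, hz.norm_eq, mul_one]
  refine ⟨min δ ρ, hρ0, ‖D‖ / κ, G, ?_, fun v h1 h2 => (hG v h1 h2).2, fun v₁ v₂ n1 n2 h1 h2 => ?_⟩
  · have hnear : ∀ᶠ u in 𝓝 u₀, ‖z u - z u₀‖ < min δ ρ := by
      have : Continuous fun u => ‖z u - z u₀‖ := by
        have := hz.continuous
        fun_prop
      exact this.continuousAt.eventually (gt_mem_nhds (by simpa using hρ0))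
    filter_upwards [hnear, Icc_mem_nhds (show u₀ - δ / 2 < u₀ by linarith)
      (show u₀ < u₀ + δ / 2 by linarith)] with u hu1 hu2
    obtain ⟨g1, g2⟩ := hG (z u) (hz.norm_eq _) hu1
    have := key (z u) _ g1 _ hu2 hu1 g2
    rw [g2, sub_self, norm_zero, mul_zero] at this
    have h3 : |G (z u) - u| ≤ 0 := by
      by_contra hc
      have := mul_pos hκ0 (not_le.1 hc)
      linarith
    exact sub_eq_zero.1 (abs_nonpos_iff.1 h3)
  · have g1 := hG v₁ n1 h1
    have g2 := hG v₂ n2 h2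
    have := key v₁ _ g1.1 _ g2.1 h1 g1.2
    rw [g1.2, g2.2] at this
    rw [div_mul_eq_mul_div, le_div_iff₀ hκ0, mul_comm]
    exact this

include hr hz

variable (hr1 : ∀ s, ‖r' s‖ = 1) (hz1 : ∀ s, ‖z' s‖ = 1) {c : ℝ → Y} (hc1 : ∀ s, ‖c s‖ = 1)
  (hc : ∀ s t, ‖c s - c t‖ = ‖r s - r t‖)
include hr1 hz1 hc1 hc

/-- A curve on the sphere with the same mutual distances as a unit-speed curve is locally a shift
of the given unit-speed parametrization, up to orientation. -/
theorem eventually_eq_of_isometric {s₀ u₀ : ℝ} (h0 : c s₀ = z u₀) :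
    ∃ ε : ℝ, (ε = 1 ∨ ε = -1) ∧ ∀ᶠ s in 𝓝 s₀, c s = z (u₀ + ε * (s - s₀)) := by
  obtain ⟨ρ, hρ, K, G, hG0, hG1, hG2⟩ := hz.exists_local_parameter u₀
  obtain ⟨-, -, -, G', hG', -, -⟩ := hr.exists_local_parameter s₀
  have hnear : ∀ᶠ s in 𝓝 s₀, ‖c s - z u₀‖ < ρ := by
    simp only [← h0, hc]
    have : Continuous fun s => ‖r s - r s₀‖ := by
      have := hr.continuous
      fun_prop
    exact this.continuousAt.eventually (gt_mem_nhds (by simpa using hρ))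
  obtain ⟨τ, hτ, hball⟩ := Metric.eventually_nhds_iff.1 (hnear.and hG')
  set I := Ioo (s₀ - τ) (s₀ + τ) with hI
  have hmem : ∀ s ∈ I, ‖c s - z u₀‖ < ρ ∧ G' (r s) = s := fun s hs =>
    hball (by rw [Real.dist_eq, abs_lt]; constructor <;> linarith [hs.1, hs.2])
  set g : ℝ → ℝ := fun s => G (c s) with hg
  have hzg : ∀ s ∈ I, z (g s) = c s := fun s hs => hG1 _ (hc1 s) (hmem s hs).1
  have hs₀ : s₀ ∈ I := ⟨by linarith, by linarith⟩
  have hg0 : g s₀ = u₀ := by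
    simp only [hg, h0]
    exact hG0.self_of_nhds
  have hinj : InjOn g I := by
    intro s hs t ht hst
    have h1 : ‖r s - r t‖ = 0 := by
      rw [← hc, ← hzg s hs, ← hzg t ht, hst, sub_self, norm_zero]
    rw [← (hmem s hs).2, ← (hmem t ht).2, sub_eq_zero.1 (norm_eq_zero.1 h1)]
  have hgc : ∀ s ∈ I, ContinuousAt g s := by
    intro s hs
    refine tendsto_iff_dist_tendsto_zero.2 (squeeze_zero'
      (Eventually.of_forall fun _ => dist_nonneg) (g := fun t => K * ‖r t - r s‖) ?_ ?_)
    · filter_upwards [isOpen_Ioo.mem_nhds hs] with t ht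
      rw [← hc]
      exact hG2 _ _ (hc1 t) (hc1 s) (hmem t ht).1 (hmem s hs).1
    · have h2 : Continuous fun t => K * ‖r t - r s‖ := by
        have := hr.continuous
        fun_prop
      simpa using h2.tendsto s
  -- both `r` and `z` have unit speed, so the difference quotients of `g` are asymptotically `±1`
  have habs : ∀ s ∈ I, Tendsto (fun t => |slope g s t|) (𝓝[≠] s) (𝓝 1) := by
    intro s hs
    have l1 : Tendsto (fun t => ‖slope r s t‖) (𝓝[≠] s) (𝓝 1) := by
      have := (hasDerivAt_iff_tendsto_slope.1 (hr.hasDerivAt s)).norm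
      rwa [hr1] at this
    have l2 : Tendsto (fun t => ‖dslope z (g s) (g t)‖) (𝓝[≠] s) (𝓝 1) := by
      have h1 : ContinuousAt (dslope z (g s)) (g s) :=
        continuousAt_dslope_same.2 (hz.hasDerivAt _).differentiableAt
      have h2 := (h1.tendsto.comp (hgc s hs).tendsto).norm
      rw [dslope_same, (hz.hasDerivAt _).deriv, hz1] at h2
      exact h2.mono_left nhdsWithin_le_nhds
    have l3 := l1.div l2 one_ne_zero
    rw [div_one] at l3
    refine l3.congr' ?_
    filter_upwards [l2.eventually (lt_mem_nhds one_pos), self_mem_nhdsWithin,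
      mem_nhdsWithin_of_mem_nhds (isOpen_Ioo.mem_nhds hs)] with t h1 h2 h3
    have e1 : (g t - g s) • dslope z (g s) (g t) = c t - c s := by
      rw [sub_smul_dslope, hzg t h3, hzg s hs]
    have e2 := congrArg norm e1
    rw [norm_smul, hc, Real.norm_eq_abs] at e2
    simp only [Pi.div_apply]
    rw [div_eq_iff h1.ne', slope_def_module, slope_def_field, norm_smul, abs_div, ← e2, norm_inv,
      Real.norm_eq_abs]
    ring
  -- a continuous injective function on an interval is strictly monotone, which fixes the sign
  have hsign : ∃ ε : ℝ, (ε = 1 ∨ ε = -1) ∧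
      ∀ s ∈ I, ∀ t ∈ I, s ≠ t → slope g s t = ε * |slope g s t| := by
    have hco : ContinuousOn g I := fun s hs => (hgc s hs).continuousWithinAt
    rcases hco.strictMonoOn_of_injOn_Ioo (by linarith) hinj with hm | hm
    · refine ⟨1, Or.inl rfl, fun s hs t ht hst => ?_⟩
      rw [one_mul, abs_of_nonneg]
      rw [slope_def_field]
      rcases hst.lt_or_gt with h1 | h1
      · exact div_nonneg (sub_nonneg.2 (hm hs ht h1).le) (sub_nonneg.2 h1.le)
      · exact div_nonneg_of_nonpos (sub_nonpos.2 (hm ht hs h1).le) (sub_nonpos.2 h1.le)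
    · refine ⟨-1, Or.inr rfl, fun s hs t ht hst => ?_⟩
      rw [abs_of_nonpos, neg_mul_neg, one_mul]
      rw [slope_def_field]
      rcases hst.lt_or_gt with h1 | h1
      · exact div_nonpos_of_nonpos_of_nonneg (sub_nonpos.2 (hm hs ht h1).le) (sub_nonneg.2 h1.le)
      · exact div_nonpos_of_nonneg_of_nonpos (sub_nonneg.2 (hm ht hs h1).le) (sub_nonpos.2 h1.le)
  obtain ⟨ε, hε, hsl⟩ := hsign
  have hder : ∀ s ∈ I, HasDerivAt g ε s := by
    intro s hs
    rw [hasDerivAt_iff_tendsto_slope]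
    have h1 := (habs s hs).const_mul ε
    rw [mul_one] at h1
    refine h1.congr' ?_
    filter_upwards [self_mem_nhdsWithin, mem_nhdsWithin_of_mem_nhds (isOpen_Ioo.mem_nhds hs)]
      with t h2 h3
    exact (hsl s hs t h3 (Ne.symm h2)).symm
  refine ⟨ε, hε, ?_⟩
  filter_upwards [isOpen_Ioo.mem_nhds hs₀] with s hs
  have h3 := (convex_Ioo (s₀ - τ) (s₀ + τ)).norm_image_sub_le_of_norm_hasDerivWithin_le
    (f := fun t => g t - ε * t) (f' := fun _ => 0) (C := 0)
    (fun t ht => by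
      have := (hder t ht).fun_sub ((hasDerivAt_id t).const_mul ε)
      simp only [mul_one, sub_self, id] at this
      exact this.hasDerivWithinAt)
    (fun t _ => by simp) hs₀ hs
  rw [zero_mul] at h3
  have h4 := sub_eq_zero.1 (norm_le_zero_iff.1 h3)
  rw [← hzg s hs]
  congr 1
  rw [hg0] at h4
  linarith

/-- A curve on the sphere with the same mutual distances as a unit-speed curve is globally a shift
of the given unit-speed parametrization, up to orientation. -/
theorem eq_of_isometric {s₀ u₀ : ℝ} (h0 : c s₀ = z u₀) :
    ∃ ε : ℝ, (ε = 1 ∨ ε = -1) ∧ ∀ s, c s = z (u₀ + ε * (s - s₀)) := by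
  obtain ⟨ε, hε, hloc⟩ := eventually_eq_of_isometric hr hz hr1 hz1 hc1 hc h0
  refine ⟨ε, hε, ?_⟩
  have hcc : Continuous c := by
    rw [continuous_iff_continuousAt]
    intro s
    refine tendsto_iff_norm_sub_tendsto_zero.2 ?_
    simp only [hc]
    exact tendsto_iff_norm_sub_tendsto_zero.1 hr.continuous.continuousAt
  have hdz : ∀ (v e a s : ℝ),
      HasDerivAt (fun s => z (v + e * (s - a))) (e • z' (v + e * (s - a))) s := by
    intro v e a s
    have h1 : HasDerivAt (fun s => v + e * (s - a)) e s := by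
      simpa using (((hasDerivAt_id s).sub_const a).const_mul e).const_add v
    exact (hz.hasDerivAt _).scomp s h1
  set S := {s | ∀ᶠ t in 𝓝 s, c t = z (u₀ + ε * (t - s₀))} with hS
  have hopen : IsOpen S := isOpen_iff_mem_nhds.2 fun s hs => eventually_eventually_nhds.2 hs
  have hclosed : IsClosed S := by
    refine isClosed_of_closure_subset fun s hs => ?_
    have hval : c s = z (u₀ + ε * (s - s₀)) := by
      have hcl : IsClosed {t | c t = z (u₀ + ε * (t - s₀))} :=
        isClosed_eq hcc (hz.continuous.comp (by fun_prop))
      exact closure_minimal (fun t ht => Eventually.self_of_nhds ht) hcl hs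
    obtain ⟨ε₁, hε₁, h1⟩ := eventually_eq_of_isometric hr hz hr1 hz1 hc1 hc hval
    obtain ⟨t, ht1, ht2⟩ := mem_closure_iff_nhds.1 hs _ (eventually_eventually_nhds.2 h1)
    have hEq : (fun t => z (u₀ + ε * (t - s₀))) =ᶠ[𝓝 t]
        fun t => z (u₀ + ε * (s - s₀) + ε₁ * (t - s)) := by
      filter_upwards [ht1, ht2] with t' e1 e2
      rw [← e1, ← e2]
    have hd := (hdz u₀ ε s₀ t).unique ((hdz (u₀ + ε * (s - s₀)) ε₁ s t).congr_of_eventuallyEq hEq)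
    have hp := hEq.self_of_nhds
    simp only at hp
    have hd2 := congrArg (D (z (u₀ + ε * (t - s₀)))) hd
    nth_rewrite 2 [hp] at hd2
    rw [map_smul, map_smul, smul_eq_mul, smul_eq_mul] at hd2
    have w1 := hz.pos (u₀ + ε * (t - s₀))
    have w2 := hz.pos (u₀ + ε * (s - s₀) + ε₁ * (t - s))
    -- at `t` the two shifts pass through the same point with velocities `ε z'` and `ε₁ z'`
    have hεε : ε₁ = ε := by
      rcases hε with rfl | rfl <;> rcases hε₁ with rfl | rfl <;> first | rfl | (exfalso; linarith)
    subst hεε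
    filter_upwards [h1] with t' e1
    rw [e1]; congr 1; ring
  have huniv := IsClopen.eq_univ ⟨hclosed, hopen⟩ ⟨s₀, hloc⟩
  intro s
  have : ∀ᶠ t in 𝓝 s, c t = z (u₀ + ε * (t - s₀)) := huniv.symm.subset (mem_univ s)
  exact this.self_of_nhds

end SphereCurve

end UnitSpeed

/-! ### Antipodes and periods -/

section Antipodes

variable {X : Type*} [NormedAddCommGroup X] [NormedSpace ℝ X]
variable {Y : Type*} [NormedAddCommGroup Y] [NormedSpace ℝ Y]

namespace SphereCurve

variable {D : X →L[ℝ] X →L[ℝ] ℝ} {z z' : ℝ → X} (hz : SphereCurve D z z')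
  (hz1 : ∀ s, ‖z' s‖ = 1)
include hz hz1

/-- An orientation-preserving isometric motion of a unit-speed curve is a shift. -/
theorem eq_shift {c : ℝ → X} {c' : X} (hc1 : ∀ s, ‖c s‖ = 1)
    (hc : ∀ s t, ‖c s - c t‖ = ‖z s - z t‖) (hd : HasDerivAt c c' 0) (hpos : 0 < D (c 0) c')
    {p : ℝ} (h0 : c 0 = z p) (s : ℝ) : c s = z (s + p) := by
  obtain ⟨ε, hε, H⟩ := eq_of_isometric hz hz hz1 hz1 hc1 hc h0
  have h1 : HasDerivAt (fun s => z (p + ε * (s - 0))) (ε • z' (p + ε * (0 - 0))) 0 := by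
    have h1 : HasDerivAt (fun s => p + ε * (s - 0)) ε (0 : ℝ) := by
      simpa using ((hasDerivAt_id (0 : ℝ)).const_mul ε).const_add p
    exact (hz.hasDerivAt _).scomp (0 : ℝ) h1
  rw [← funext H] at h1
  have h2 := hd.unique h1
  rw [h2, h0, sub_zero, mul_zero, add_zero, map_smul, smul_eq_mul] at hpos
  have h3 := hz.pos p
  rcases hε with rfl | rfl
  · rw [H]; congr 1; ring
  · exfalso; linarith

theorem periodic_of_eq {p : ℝ} (h : z p = z 0) : Function.Periodic z p := fun s =>
  (hz.eq_shift hz1 hz.norm_eq (fun _ _ => rfl) (hz.hasDerivAt 0) (hz.pos 0) h.symm s).symm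

/-- The shift carrying `z 0` to `-z 0` carries every point to its antipode, because `s ↦ -z s` is an
orientation-preserving isometric motion of the curve. -/
theorem exists_antiperiod (hrange : range z = Metric.sphere 0 1) :
    ∃ L, Function.Antiperiodic z L := by
  have : -z 0 ∈ range z := by rw [hrange]; simp [hz.norm_eq]
  obtain ⟨L, hL⟩ := this
  refine ⟨L, fun s => ?_⟩
  refine (hz.eq_shift hz1 (c := fun s => -z s) (fun s => by rw [norm_neg, hz.norm_eq])
    (fun s t => ?_) (hz.hasDerivAt 0).fun_neg (by simpa using hz.pos 0) hL.symm s).symm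
  rw [← norm_neg]; congr 1; abel

/-- Two half-periods which are not periods differ by a period, since the group of periods is
cyclic. -/
theorem periodic_sub_of_half {p q : ℝ} (hp : Function.Periodic z (2 * p))
    (hq : Function.Periodic z (2 * q)) (hp' : ¬ Function.Periodic z p)
    (hq' : ¬ Function.Periodic z q) : Function.Periodic z (p - q) := by
  -- the group of periods, which is closed and not dense
  let P : AddSubgroup ℝ :=
    { carrier := {a | Function.Periodic z a}
      add_mem' := fun ha hb => ha.add_period hb
      zero_mem' := fun s => by rw [add_zero]
      neg_mem' := fun ha => ha.neg }
  have hclosed : IsClosed (P : Set ℝ) := by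
    have : (P : Set ℝ) = {a | z a = z 0} := by
      ext a
      refine ⟨fun h => ?_, fun h => hz.periodic_of_eq hz1 h⟩
      have := h 0
      rwa [zero_add] at this
    rw [this]
    exact isClosed_eq hz.continuous continuous_const
  rcases P.dense_or_cyclic with hd | ⟨a, ha⟩
  · exact absurd (show p ∈ (P : Set ℝ) by rw [← hclosed.closure_eq, hd.closure_eq]; trivial) hp'
  · have hmem : ∀ b : ℝ, Function.Periodic z b ↔ ∃ n : ℤ, n • a = b := fun b => by
      change b ∈ P ↔ _
      rw [ha, AddSubgroup.mem_closure_singleton]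
    -- twice a half-period which is not a period is an odd multiple of the generator `a`
    have hodd : ∀ {b : ℝ}, Function.Periodic z (2 * b) → ¬ Function.Periodic z b →
        ∃ k : ℤ, (2 * k + 1 : ℤ) • a = 2 * b := by
      intro b h1 h2
      obtain ⟨n, hn⟩ := (hmem _).1 h1
      rcases Int.even_or_odd' n with ⟨k, rfl | rfl⟩
      · refine absurd ((hmem _).2 ⟨k, ?_⟩) h2
        rw [zsmul_eq_mul] at hn ⊢
        push_cast at hn
        linarith
      · exact ⟨k, hn⟩
    obtain ⟨k, hk⟩ := hodd hp hp'
    obtain ⟨l, hl⟩ := hodd hq hq'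
    refine (hmem _).2 ⟨k - l, ?_⟩
    rw [zsmul_eq_mul] at hk hl ⊢
    push_cast at hk hl ⊢
    linarith

omit hz1 in
theorem not_periodic_of_antiperiodic {L : ℝ} (hL : Function.Antiperiodic z L) :
    ¬ Function.Periodic z L := fun h => by
  have h1 : z 0 = -z 0 := (h 0).symm.trans (hL 0)
  have h2 : z 0 = 0 := by
    have h3 : (2 : ℝ) • z 0 = 0 := by rw [two_smul]; nth_rewrite 1 [h1]; exact neg_add_cancel _
    exact (smul_eq_zero.1 h3).resolve_left two_ne_zero
  have := hz.norm_eq 0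
  rw [h2, norm_zero] at this
  norm_num at this

end SphereCurve

/-- A map of one unit-speed sphere onto another which preserves distances preserves antipodes. -/
theorem SphereCurve.antiperiodic_of_isometric {DX : X →L[ℝ] X →L[ℝ] ℝ} {r r' : ℝ → X}
    (hr : SphereCurve DX r r') {DY : Y →L[ℝ] Y →L[ℝ] ℝ} {q q' : ℝ → Y}
    (hq : SphereCurve DY q q') (hq1 : ∀ s, ‖q' s‖ = 1) (hrange : range q = Metric.sphere 0 1)
    (h : ∀ s t, ‖q s - q t‖ = ‖r s - r t‖) {L : ℝ} (hL : Function.Antiperiodic r L) :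
    Function.Antiperiodic q L := by
  have hper : ∀ p, Function.Periodic q p ↔ Function.Periodic r p := by
    intro p
    have : ∀ s, q (s + p) = q s ↔ r (s + p) = r s := fun s => by
      rw [← sub_eq_zero, ← norm_eq_zero, h, norm_eq_zero, sub_eq_zero]
    exact forall_congr' this
  obtain ⟨L', hL'⟩ := hq.exists_antiperiod hq1 hrange
  have h1 := hq.periodic_sub_of_half hq1 ((hper _).2 hL.periodic_two_mul) hL'.periodic_two_mul
    (fun hc => hr.not_periodic_of_antiperiodic hL ((hper _).1 hc))
    (hq.not_periodic_of_antiperiodic hL')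
  intro s
  have h2 := h1 (s + L')
  rw [add_assoc, add_sub_cancel] at h2
  rw [h2, hL']

end Antipodes

/-! ### The area parametrization -/

section AreaParametrization

variable {X : Type*} [NormedAddCommGroup X] [NormedSpace ℝ X]

namespace SphereCurve

variable {D : X →L[ℝ] X →L[ℝ] ℝ} {z z' : ℝ → X} (hz : SphereCurve D z z')
include hz

/-- The change of variable which turns a periodic curve into one parametrized by twice the area of
the sector swept out. -/
theorem exists_area_parameter {T : ℝ} (hT : 0 < T) (hper : Function.Periodic z T) :
    ∃ (g : ℝ → ℝ) (T' : ℝ), 0 < T' ∧ (∀ s, HasDerivAt g (D (z (g s)) (z' (g s)))⁻¹ s) ∧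
      Function.Surjective g ∧ ∀ s, g (s + T') = g s + T := by
  obtain ⟨δ, hδ, c, hc, hle⟩ := hz.exists_forall_le_area hT hper
  have hper' := hper.deriv_of_hasDerivAt hz.hasDerivAt
  set w : ℝ → ℝ := fun s => D (z s) (z' s) with hw
  have hwc : Continuous w := hz.continuous_area.comp (continuous_id.prodMk continuous_id)
  have hwle : ∀ s, c ≤ w s := fun s => hle s s (by rw [sub_self, abs_zero]; exact hδ.le)
  have hwp : Function.Periodic w T := fun s => by simp only [hw, hper s, hper' s]
  have hint : ∀ a b, IntervalIntegrable w volume a b := fun a b => hwc.intervalIntegrable a b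
  -- `A` is twice the area swept out; its inverse is the required change of variable
  set A : ℝ → ℝ := fun s => ∫ u in (0 : ℝ)..s, w u with hA
  have hAd : ∀ s, HasDerivAt A (w s) s := fun s =>
    intervalIntegral.integral_hasDerivAt_right (hint _ _)
      (hwc.stronglyMeasurableAtFilter _ _) hwc.continuousAt
  have hAm : StrictMono A := strictMono_of_hasDerivAt_pos hAd fun s => hz.pos s
  have hAc : Continuous A := continuous_iff_continuousAt.2 fun s => (hAd s).continuousAt
  have hgrow : ∀ s t, s ≤ t → c * (t - s) ≤ A t - A s := by
    intro s t hst
    have h1 : ∫ u in s..t, c ≤ ∫ u in s..t, w u :=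
      intervalIntegral.integral_mono_on hst (by simp) (hint _ _) fun u _ => hwle u
    rw [intervalIntegral.integral_const, smul_eq_mul] at h1
    rw [hA, intervalIntegral.integral_interval_sub_left (hint _ _) (hint _ _)]
    linarith
  have hA0 : A 0 = 0 := by simp [hA]
  have hsurj : Function.Surjective A := by
    refine hAc.surjective ?_ ?_
    · refine tendsto_atTop_mono' _ ?_ (tendsto_id.const_mul_atTop hc)
      filter_upwards [eventually_ge_atTop 0] with s hs
      have := hgrow 0 s hs
      simp only [id]; linarith
    · refine tendsto_atBot_mono' _ ?_ (tendsto_id.const_mul_atBot hc)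
      filter_upwards [eventually_le_atBot 0] with s hs
      have := hgrow s 0 hs
      simp only [id]; linarith
  let e := hAm.orderIsoOfSurjective A hsurj
  have hAe : ∀ s, A (e.symm s) = s := fun s => e.apply_symm_apply s
  have heA : ∀ s, e.symm (A s) = s := fun s => e.symm_apply_apply s
  refine ⟨e.symm, A T, ?_, fun s => ?_, e.symm.surjective, fun s => ?_⟩
  · rw [← hA0]; exact hAm hT
  · exact (hAd (e.symm s)).of_local_left_inverse e.symm.continuous.continuousAt (hz.pos _).ne'
      (Eventually.of_forall hAe)
  · apply hAm.injective
    have h1 : A (e.symm s + T) - A (e.symm s) = A T := by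
      rw [hA, intervalIntegral.integral_interval_sub_left (hint _ _) (hint _ _),
        hwp.intervalIntegral_add_eq _ 0, zero_add]
    rw [hAe]
    have h2 := hAe s
    linarith

/-- A change of variable along a flow with positive, locally absolutely continuous speed. -/
theorem comp {v g : ℝ → ℝ} (hv : LocallyAbsolutelyContinuous v) (hpos : ∀ s, 0 < v s)
    (hg : ∀ s, HasDerivAt g (v (g s)) s) :
    SphereCurve D (fun s => z (g s)) fun s => v (g s) • z' (g s) where
  area := hz.area
  norm_eq s := hz.norm_eq _
  hasDerivAt s := (hz.hasDerivAt (g s)).scomp s (hg s)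
  lac := by
    have hgc : Continuous g := continuous_iff_continuousAt.2 fun s => (hg s).continuousAt
    exact (hv.smul hz.lac).comp_strictMono hg (hv.continuous.comp hgc)
      (strictMono_of_hasDerivAt_pos hg fun s => hpos _)
  pos s := by
    rw [map_smul, smul_eq_mul]
    exact mul_pos (hpos _) (hz.pos _)

end SphereCurve

end AreaParametrization

/-! ### The linear extension -/

section SphereMaps

variable {X : Type*} [NormedAddCommGroup X] [NormedSpace ℝ X]
variable {Y : Type*} [NormedAddCommGroup Y] [NormedSpace ℝ Y]

/-- A unit-speed curve covering the sphere of `X` and its isometric image covering the sphere of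
`Y` correspond under a linear map. -/
theorem exists_linearMap_of_isometric [FiniteDimensional ℝ X] [FiniteDimensional ℝ Y]
    {DX : X →L[ℝ] X →L[ℝ] ℝ} {r r' : ℝ → X}
    (hr : SphereCurve DX r r') (hr1 : ∀ s, ‖r' s‖ = 1) (hrr : range r = Metric.sphere 0 1)
    {DY : Y →L[ℝ] Y →L[ℝ] ℝ} {q q' : ℝ → Y}
    (hq : SphereCurve DY q q') (hq1 : ∀ s, ‖q' s‖ = 1) (hqr : range q = Metric.sphere 0 1)
    (h : ∀ s t, ‖q s - q t‖ = ‖r s - r t‖) : ∃ F : X →ₗ[ℝ] Y, ∀ s, F (r s) = q s := by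
  obtain ⟨L, hL⟩ := hr.exists_antiperiod hr1 hrr
  have hL' := hr.antiperiodic_of_isometric hq hq1 hqr h hL
  have hL0 : L ≠ 0 := by
    rintro rfl
    exact hr.not_periodic_of_antiperiodic hL fun s => by rw [add_zero]
  obtain ⟨T, hT, hTr, hTq⟩ : ∃ T, 0 < T ∧ Function.Periodic r T ∧ Function.Periodic q T := by
    rcases hL0.lt_or_gt with h1 | h1
    · exact ⟨-(2 * L), by linarith, hL.periodic_two_mul.neg, hL'.periodic_two_mul.neg⟩
    · exact ⟨2 * L, by linarith, hL.periodic_two_mul, hL'.periodic_two_mul⟩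
  obtain ⟨g, T', hT', hg, hgs, hgT⟩ := hr.exists_area_parameter hT hTr
  have hpos : ∀ s, 0 < (DX (r s) (r' s))⁻¹ := fun s => inv_pos.2 (hr.pos s)
  have hlac := hr.lac_area.inv hr.pos
  have hpair : HillPair DX DY (fun s => r (g s)) (fun s => (DX (r (g s)) (r' (g s)))⁻¹ • r' (g s))
      (fun s => q (g s)) (fun s => (DX (r (g s)) (r' (g s)))⁻¹ • q' (g s)) T' :=
    { left := hr.comp hlac hpos hg
      right := hq.comp hlac hpos hg
      area_eq_one := fun s => by
        rw [map_smul, smul_eq_mul, inv_mul_cancel₀ (hr.pos _).ne']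
      pos := hT'
      periodic_left := fun s => by simp only [hgT, hTr (g s)]
      periodic_right := fun s => by simp only [hgT, hTq (g s)]
      norm_sub := fun s t => (h _ _).symm
      norm_add := fun s t => by
        have h1 := h (g s) (g t + L)
        rw [hL, hL', sub_neg_eq_add, sub_neg_eq_add] at h1
        exact h1.symm }
  obtain ⟨F, hF⟩ := hpair.exists_linearMap
  refine ⟨F, fun s => ?_⟩
  obtain ⟨t, rfl⟩ := hgs s
  exact hF t

/-- A linear map carrying unit vectors to unit vectors is isometric. -/
theorem LinearMap.norm_map_of_norm_map_unit (F : X →ₗ[ℝ] Y) (h : ∀ v, ‖v‖ = 1 → ‖F v‖ = 1)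
    (v : X) : ‖F v‖ = ‖v‖ := by
  rcases eq_or_ne v 0 with rfl | hv
  · simp
  · have h1 := h (‖v‖⁻¹ • v) (norm_smul_inv_norm hv)
    rw [map_smul, norm_smul, norm_inv, norm_norm, inv_mul_eq_div,
      div_eq_one_iff_eq (by simpa)] at h1
    exact h1

end SphereMaps

theorem theorem1
    {X : Type*} [NormedAddCommGroup X] [NormedSpace ℝ X]
    {Y : Type*} [NormedAddCommGroup Y] [NormedSpace ℝ Y]
    (hX2 : Module.finrank ℝ X = 2) (hY2 : Module.finrank ℝ Y = 2)
    (hX : AbsolutelySmooth X) (hY : AbsolutelySmooth Y)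
    (f : Metric.sphere (0 : X) 1 → Metric.sphere (0 : Y) 1) (hf : Isometry f) :
    ∃ F : X ≃ₗᵢ[ℝ] Y, ∀ x : Metric.sphere (0 : X) 1, F (x : X) = (f x : Y) := by
  have : FiniteDimensional ℝ X := Module.finite_of_finrank_pos (by omega)
  have : FiniteDimensional ℝ Y := Module.finite_of_finrank_pos (by omega)
  obtain ⟨r, hrr, hrd, hr1, hrl⟩ := hX
  obtain ⟨p, hpr, hpd, hp1, hpl⟩ := hY
  have hmem : ∀ s, r s ∈ Metric.sphere (0 : X) 1 := fun s => hrr ▸ mem_range_self s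
  have hn : ∀ s, ‖r s‖ = 1 := fun s => by simpa using hmem s
  have hpn : ∀ s, ‖p s‖ = 1 := fun s => by
    have : p s ∈ Metric.sphere (0 : Y) 1 := hpr ▸ mem_range_self s
    simpa using this
  have hne : ∀ {v : X}, ‖v‖ = 1 → v ≠ 0 := fun h h0 => by simp [h0] at h
  have hne' : ∀ {v : Y}, ‖v‖ = 1 → v ≠ 0 := fun h h0 => by simp [h0] at h
  obtain ⟨DX, hr⟩ := exists_sphereCurve hX2 hn (fun s => (hrd s).hasDerivAt) hrl
    fun s => hne (hr1 s)
  obtain ⟨DY, hp⟩ := exists_sphereCurve hY2 hpn (fun s => (hpd s).hasDerivAt) hpl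
    fun s => hne' (hp1 s)
  set c : ℝ → Y := fun s => f ⟨r s, hmem s⟩ with hc
  have hcn : ∀ s, ‖c s‖ = 1 := fun s => mem_sphere_zero_iff_norm.1 (f ⟨r s, hmem s⟩).2
  have hcd : ∀ s t, ‖c s - c t‖ = ‖r s - r t‖ := fun s t => by
    rw [← dist_eq_norm, ← dist_eq_norm]
    exact hf.dist_eq ⟨r s, hmem s⟩ ⟨r t, hmem t⟩
  obtain ⟨u, hu⟩ : c 0 ∈ range p := by rw [hpr]; exact mem_sphere_zero_iff_norm.2 (hcn 0)
  obtain ⟨ε, hε, hcp⟩ := SphereCurve.eq_of_isometric hr hp hr1 hp1 hcn hcd hu.symm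
  have hε2 : ε * ε = 1 := by rcases hε with rfl | rfl <;> norm_num
  have hεn : ‖ε‖ = 1 := by rcases hε with rfl | rfl <;> simp
  simp only [sub_zero] at hcp
  -- the reparametrization `s ↦ u + ε s` of `p` may reverse the orientation
  have hcder : ∀ s, HasDerivAt c (ε • deriv p (u + ε * s)) s := fun s => by
    rw [funext hcp]
    have h1 : HasDerivAt (fun s => u + ε * s) ε s := by
      simpa using ((hasDerivAt_id s).const_mul ε).const_add u
    exact (hp.hasDerivAt _).scomp s h1
  have hc1 : ∀ s, ‖ε • deriv p (u + ε * s)‖ = 1 := fun s => by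
    rw [norm_smul, hεn, hp1, one_mul]
  have hlac : LocallyAbsolutelyContinuous fun s => ε • deriv p (u + ε * s) := by
    have h1 : LocallyAbsolutelyContinuous fun s => deriv p (u + s) :=
      hpl.comp_strictMono (g' := fun _ => 1) (fun s => (hasDerivAt_id s).const_add u)
        continuous_const fun a b hab => by linarith
    have h2 : LocallyAbsolutelyContinuous fun s => deriv p (u + ε * s) := by
      rcases hε with rfl | rfl
      · simpa only [one_mul] using h1
      · simpa only [neg_one_mul] using h1.comp_neg
    exact LocallyAbsolutelyContinuous.clm (ε • ContinuousLinearMap.id ℝ Y) h2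
  have hcr : range c = Metric.sphere 0 1 := by
    refine Subset.antisymm (range_subset_iff.2 fun s => mem_sphere_zero_iff_norm.2 (hcn s)) ?_
    rw [← hpr]
    rintro _ ⟨t, rfl⟩
    refine ⟨ε * (t - u), ?_⟩
    rw [hcp, ← mul_assoc, hε2, one_mul, add_sub_cancel]
  obtain ⟨DY', hc'⟩ := exists_sphereCurve hY2 hcn hcder hlac fun s => hne' (hc1 s)
  obtain ⟨F, hF⟩ := exists_linearMap_of_isometric hr hr1 hrr hc' hc1 hcr hcd
  have hFf : ∀ x : Metric.sphere (0 : X) 1, F x = f x := fun x => by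
    obtain ⟨s, hs⟩ : (x : X) ∈ range r := by rw [hrr]; exact x.2
    rw [← hs, hF]
    exact congrArg (fun y => (f y : Y)) (Subtype.ext hs)
  have hFn := LinearMap.norm_map_of_norm_map_unit F fun v hv => by
    rw [hFf ⟨v, mem_sphere_zero_iff_norm.2 hv⟩]
    exact mem_sphere_zero_iff_norm.1 (f _).2
  exact ⟨LinearIsometry.toLinearIsometryEquiv ⟨F, hFn⟩ (hX2.trans hY2.symm), hFf⟩
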